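/- **Setting.** Let $(\Omega,\mathcal F,P)$ be a probability space, $\mathcal Y$ a compact interval with the cutoff $k$ in its interior, $\mathcal X\subseteq\mathbb R^{d_x}$, $\mathcal H\subseteq\mathbb R$, $\Theta\subseteq\mathbb R^{d_\theta}$ with $\theta_0\in\Theta$, and $X:\Omega\to\mathcal X$, $\eta:\Omega\to\mathcal H$, $Y:\Omega\to\mathbb R$ random variables. *Payoffs.* For $d\in\{0,1\}$, $x\in\mathcal X$, $\eta\in\mathcal H$, $\theta\in\Theta$ the payoff $y\mapsto U_d(y,x,\eta,\theta)$ is strictly concave on $\mathcal Y$, and $U_0-U_1$ is $\le 0$ for $y<k$, $=0$ at $y=k$, and $\ge 0$ for $y>k$. The maximizer of $U_d$ over $\mathcal Y$ is $m(d,x,\eta,\theta)$. Put $Y^*(d)=m(d,X,\eta,\theta_0)$, and let $Y^*$ maximize over $\mathcal Y$ the actual payoff, equal to $U_0$ for $y\le k$ and to $U_1$ for $y>k$, at $(X,\eta,\theta_0)$. *Structural equations.* For all $d,x,\theta$ the map $\eta\mapsto m(d,x,\eta,\theta)$ is strictly increasing on $\mathcal H$; $(x,\eta)\mapsto m(d,x,\eta,\theta)$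 and $(x,y)\mapsto m^{-1}(d,x,y,\theta)$ are continuous. Put $R(y,x,\theta)=m(0,x,m^{-1}(1,x,y,\theta),\theta)$. *Data.* $[k_0,k_1]\subseteq\mathcal Y$ contains $k$, and $R(k_1,x,\theta)$ is defined for all $x\in\mathcal X$, $\theta\in\Theta$. If $Y^*=k$ then $Y\in[k_0,k_1]$; moreover $Y=Y^*$ whenever $Y\notin[k_0,k_1]$ or $Y^*\notin[k_0,k_1]$. For $d\in\{0,1\}$, $\mathcal Y_d=[\underline{\mathcal Y}_d,\overline{\mathcal Y}_d]$ contains $k_d$ in its interior and $Y^*(d)$ has on $\mathcal Y_d$ a density bounded above and bounded away from $0$. *Weights.* $T=\mathbf t(X)\ge 0$ is bounded and $E[T\mid Y^*(0)=y]\ge c_1>0$ for almost all $y\in\mathcal Y_0$; $P_T(A)=E[\mathbf 1_AT]/E[T]$. *Upper edges.* For each $\theta\in\Theta$, $\bar k_1(\theta)\in[k,\overline{\mathcal Y}_0]$, $\bar k_1(\theta)>k_0$, is any constant with $P_T\big(R(k_1,X,\theta)>\bar k_1(\theta),\ k_0\le Y^*(0)\le R(k_1,X,\theta)\big)=0$.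 (For $\theta=\theta_0$ the event $k_0\le Y^*(0)\le R(k_1,X,\theta)$ is $Y\in[k_0,k_1]$.) *Conditional law.* For each $\theta\in\Theta$ fix a version of the conditional distribution of $R(k_1,X,\theta)$ given $Y^*(0)=y$ under $P_T$; let $g(\tau,\theta,y)$ be its $\tau$-quantile, $\tau\in(0,1)$. Conditional expectations below are computed with it. *Analyticity.* A function $f$ and a family $(g_\tau)_{\tau\in(0,1)}$ of real functions on $[a,b]$ satisfy the analyticity condition with constants $\rho>0$, $\beta\ge0$, $\delta\ge0$ if they continue analytically to a neighborhood of the closed $\rho$-neighborhood of $[a,b]$ in $\mathbb C$ (same notation for the continuations) and (i) $\int_a^b\int_0^1|f(y+\rho e^{2\pi ix})|\,dx\,dy\le\beta\int_a^b|f(y)|\,dy$; (ii) $|g_\tau(y+\rho e^{2\pi ix})-y|\le\delta\rho$ for all $\tau\in(0,1)$, $x\in[0,1]$ and all $y\in[a,b]$ with $g_\tau(y)\ge y$; (iii) $\sup_{y\in[a,b],\,\tau\in(0,1),\,x\in[0,1]}|g_\tau(y+\rho e^{2\pi ix})|<\infty$. Assume that, for every $\theta\in\Theta$ and with constants not depending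 on $\theta$, $\bar f$ and $(g(\tau,\theta,\cdot))_\tau$ satisfy it on $[k_0,\bar k_1(\theta)]$ with $(\rho,\bar\beta,\delta)$, and $\underline f$ and $(g(\tau,\theta,\cdot))_\tau$ satisfy it with $(\rho,\underline\beta,\delta)$, where $\delta<1$. *Envelopes.* For all $y\in[k_0,\bar k_1(\theta_0)]$, $$\int_{k_0}^y\underline f(z)\,dz\ \le\ P_T(k_0\le Y^*(0)\le y)\ \le\ \int_{k_0}^y\bar f(z)\,dz .$$ **Theorem.** For $f\in\{\underline f,\bar f\}$ and $\theta\in\Theta$ all the following moments are finite and smooth in $y\in[k_0,\bar k_1(\theta)]$ and the series $$B_f(\theta)=\sum_{j=1}^\infty\frac1{j!}\,D_y^{j-1}\Big[E_{P_T}\big[(R(k_1,X,\theta)-k_0)^j\mid Y^*(0)=y\big]\,f(y)\Big]_{y=k_0}$$ (derivatives taken in $[k_0,\bar k_1(\theta)]$) converges. With $\underline B=B_{\underline f}$ and $\bar B=B_{\bar f}$, $$P_T\big(Y\in[k_0,k_1]\big)\in\big[\underline B(\theta_0),\bar B(\theta_0)\big].$$ Moreover, let $\theta\in\Theta$ and $(f,\beta)\in\{(\underline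 f,\underline\beta),(\bar f,\bar\beta)\}$. If $f\ge0$ on $[k_0,\bar k_1(\theta)]$ and $\beta$ bounds the relative variation of $f$, that is $\int_0^1|f(y+\rho e^{2\pi ix})|\,dx\le\beta|f(y)|$ for all $y\in[k_0,\bar k_1(\theta)]$, then for every integer $l\ge0$ $$\Big|\sum_{j=l+1}^\infty\frac1{j!}\,D_y^{j-1}\Big[E_{P_T}\big[(R(k_1,X,\theta)-k_0)^j\mid Y^*(0)=y\big]\,f(y)\Big]_{y=k_0}\Big|\le\beta\,\delta^l\,B_f(\theta).$$ -/

import Mathlib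

open MeasureTheory ProbabilityTheory Set

/-- The data of a kink bunching design: one population unit on a probability space `Ω`,
with observed covariates in `ℝ^dx` and a structural parameter in `ℝ^dθ`. Policy `0` is the
prekink policy and policy `1` the postkink policy. -/
structure KinkDesign (dx dθ : ℕ) (Ω : Type*) where
  /-- lower end of the compact choice interval -/
  yLo : ℝ
  /-- upper end of the compact choice interval -/
  yHi : ℝ
  /-- the cutoff -/
  k : ℝ
  /-- the optimization error window is `[win 0, win 1]` -/
  win : Fin 2 → ℝ
  /-- lower end of the interval `𝒴_d` on which the policy-`d` choice has a density -/
  sLo : Fin 2 → ℝ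
  /-- upper end of the interval `𝒴_d` -/
  sHi : Fin 2 → ℝ
  /-- the set of covariate values -/
  XX : Set (EuclideanSpace ℝ (Fin dx))
  /-- the set of heterogeneity values -/
  HH : Set ℝ
  /-- the parameter set -/
  Par : Set (EuclideanSpace ℝ (Fin dθ))
  /-- the true parameter -/
  θ₀ : EuclideanSpace ℝ (Fin dθ)
  /-- counterfactual payoffs: `U d y x η θ` -/
  U : Fin 2 → ℝ → EuclideanSpace ℝ (Fin dx) → ℝ → EuclideanSpace ℝ (Fin dθ) → ℝ
  /-- structural equations: `m d x η θ` -/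
  m : Fin 2 → EuclideanSpace ℝ (Fin dx) → ℝ → EuclideanSpace ℝ (Fin dθ) → ℝ
  /-- covariates of the unit -/
  X : Ω → EuclideanSpace ℝ (Fin dx)
  /-- unobserved heterogeneity of the unit -/
  eta : Ω → ℝ
  /-- desired choice under the actual (kinked) policy -/
  Ydes : Ω → ℝ
  /-- observed choice -/
  Y : Ω → ℝ

namespace KinkDesign

variable {dx dθ : ℕ} {Ω : Type*}

/-- The choice interval `𝒴`. -/
def choices (D : KinkDesign dx dθ Ω) : Set ℝ := Icc D.yLo D.yHi

/-- The optimization error window `[k₀, k₁]`. -/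
def window (D : KinkDesign dx dθ Ω) : Set ℝ := Icc (D.win 0) (D.win 1)

/-- The interval `𝒴_d`. -/
def supp (D : KinkDesign dx dθ Ω) (d : Fin 2) : Set ℝ := Icc (D.sLo d) (D.sHi d)

/-- The actual payoff: policy `0` up to the cutoff, policy `1` above it. -/
noncomputable def payoff (D : KinkDesign dx dθ Ω) (y : ℝ) (x : EuclideanSpace ℝ (Fin dx))
    (η : ℝ) (θ : EuclideanSpace ℝ (Fin dθ)) : ℝ :=
  if y ≤ D.k then D.U 0 y x η θ else D.U 1 y x η θ

/-- The counterfactual choice `Y*(d) = m(d, X, η, θ₀)`. -/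
def Ycf (D : KinkDesign dx dθ Ω) (d : Fin 2) (ω : Ω) : ℝ := D.m d (D.X ω) (D.eta ω) D.θ₀

/-- The inverse `m⁻¹(d, x, y, θ)` of `η ↦ m(d, x, η, θ)` on the heterogeneity set. -/
noncomputable def mInv (D : KinkDesign dx dθ Ω) (d : Fin 2) (x : EuclideanSpace ℝ (Fin dx))
    (y : ℝ) (θ : EuclideanSpace ℝ (Fin dθ)) : ℝ :=
  Function.invFunOn (fun η => D.m d x η θ) D.HH y

/-- The reversion `R(y, x, θ) = m(0, x, m⁻¹(1, x, y, θ), θ)`. -/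
noncomputable def reversion (D : KinkDesign dx dθ Ω) (y : ℝ) (x : EuclideanSpace ℝ (Fin dx))
    (θ : EuclideanSpace ℝ (Fin dθ)) : ℝ :=
  D.m 0 x (D.mInv 1 x y θ) θ

/-- The random variable `R(k₁, X, θ)`. -/
noncomputable def W (D : KinkDesign dx dθ Ω) (θ : EuclideanSpace ℝ (Fin dθ)) (ω : Ω) : ℝ :=
  D.reversion (D.win 1) (D.X ω) θ

/-- Basic conventions: the cutoff is interior to the compact choice interval, the parameter is
in the parameter set, and the unit's variables are random variables with values in the
respective sets. -/
structure Basic [MeasurableSpace Ω] (D : KinkDesign dx dθ Ω) : Prop where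
  k_mem : D.k ∈ Ioo D.yLo D.yHi
  par_mem : D.θ₀ ∈ D.Par
  X_mem : ∀ ω, D.X ω ∈ D.XX
  eta_mem : ∀ ω, D.eta ω ∈ D.HH
  X_meas : Measurable D.X
  eta_meas : Measurable D.eta
  Y_meas : Measurable D.Y

/-- Strictly concave counterfactual payoffs with single crossing at the cutoff. -/
structure KinkedPayoff (D : KinkDesign dx dθ Ω) : Prop where
  concave : ∀ d, ∀ x ∈ D.XX, ∀ η ∈ D.HH, ∀ θ ∈ D.Par,
    StrictConcaveOn ℝ D.choices (fun y => D.U d y x η θ)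
  below : ∀ y ∈ D.choices, ∀ x ∈ D.XX, ∀ η ∈ D.HH, ∀ θ ∈ D.Par,
    y < D.k → D.U 0 y x η θ - D.U 1 y x η θ ≤ 0
  cutoff : ∀ x ∈ D.XX, ∀ η ∈ D.HH, ∀ θ ∈ D.Par, D.U 0 D.k x η θ - D.U 1 D.k x η θ = 0
  above : ∀ y ∈ D.choices, ∀ x ∈ D.XX, ∀ η ∈ D.HH, ∀ θ ∈ D.Par,
    D.k < y → 0 ≤ D.U 0 y x η θ - D.U 1 y x η θ

/-- The structural equations are derived from the payoffs, and the desired choice maximizes the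
actual payoff at the true parameter. -/
structure Optimal (D : KinkDesign dx dθ Ω) : Prop where
  m_mem : ∀ d, ∀ x ∈ D.XX, ∀ η ∈ D.HH, ∀ θ ∈ D.Par, D.m d x η θ ∈ D.choices
  m_max : ∀ d, ∀ x ∈ D.XX, ∀ η ∈ D.HH, ∀ θ ∈ D.Par,
    IsMaxOn (fun y => D.U d y x η θ) D.choices (D.m d x η θ)
  des_mem : ∀ ω, D.Ydes ω ∈ D.choices
  des_max : ∀ ω, IsMaxOn (fun y => D.payoff y (D.X ω) (D.eta ω) D.θ₀) D.choices (D.Ydes ω)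

/-- The structural equations are strictly increasing in the heterogeneity, and continuous
together with their inverses (each inverse on its natural domain). -/
structure Invertible (D : KinkDesign dx dθ Ω) : Prop where
  strictMono : ∀ d, ∀ x ∈ D.XX, ∀ θ ∈ D.Par, StrictMonoOn (fun η => D.m d x η θ) D.HH
  continuous : ∀ d, ∀ θ ∈ D.Par,
    ContinuousOn (fun p : EuclideanSpace ℝ (Fin dx) × ℝ => D.m d p.1 p.2 θ) (D.XX ×ˢ D.HH)
  inv_continuous : ∀ d, ∀ θ ∈ D.Par,
    ContinuousOn (fun p : EuclideanSpace ℝ (Fin dx) × ℝ => D.mInv d p.1 p.2 θ)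
      {p | p.1 ∈ D.XX ∧ p.2 ∈ (fun η => D.m d p.1 η θ) '' D.HH}
  /-- `k₁` is in the domain of `m⁻¹(1, x, ·, θ)`, so that `R(k₁, x, θ)` is defined -/
  win_mem : ∀ x ∈ D.XX, ∀ θ ∈ D.Par, D.win 1 ∈ (fun η => D.m 1 x η θ) '' D.HH

/-- The optimization error window and the counterfactual densities. Errors neither leave the
window nor bring into it units whose desired choice lies outside. -/
structure Frictions [MeasurableSpace Ω] (D : KinkDesign dx dθ Ω) (P : Measure Ω) : Prop where
  win_subset : D.window ⊆ D.choices
  k_mem : D.k ∈ D.window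
  win_mem : ∀ d, D.win d ∈ Ioo (D.sLo d) (D.sHi d)
  buncher : ∀ ω, D.Ydes ω = D.k → D.Y ω ∈ D.window
  obs_outside : ∀ ω, D.Y ω ∉ D.window → D.Y ω = D.Ydes ω
  des_outside : ∀ ω, D.Ydes ω ∉ D.window → D.Y ω = D.Ydes ω
  density : ∃ c₁ c₂ : ℝ, 0 < c₁ ∧ c₁ ≤ c₂ ∧ ∀ d, ∃ f : ℝ → ℝ, Measurable f ∧
    (∀ y ∈ D.supp d, c₁ ≤ f y ∧ f y ≤ c₂) ∧
    (P.map (D.Ycf d)).restrict (D.supp d) =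
      (volume.restrict (D.supp d)).withDensity (fun y => ENNReal.ofReal (f y))

/-- The weight `T = t(X)` is nonnegative, bounded above by `c₂`, and its conditional expectation
given `Y*(0) = y` is at least `c₁` for (almost) all `y ∈ 𝒴₀`. -/
def IsWeight [MeasurableSpace Ω] (D : KinkDesign dx dθ Ω) (P : Measure Ω)
    (t : EuclideanSpace ℝ (Fin dx) → ℝ) : Prop :=
  Measurable t ∧ ∃ c₁ c₂ : ℝ, 0 < c₁ ∧ c₁ ≤ c₂ ∧
    (∀ ω, 0 ≤ t (D.X ω) ∧ t (D.X ω) ≤ c₂) ∧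
    ∀ᵐ ω ∂P, D.Ycf 0 ω ∈ D.supp 0 →
      c₁ ≤ (P[fun ω' => t (D.X ω') | MeasurableSpace.comap (D.Ycf 0) inferInstance]) ω

/-- The weighted probability `P_T(A) = E[1_A T] / E[T]` with `T = t(X)`. -/
noncomputable def weighted [MeasurableSpace Ω] (D : KinkDesign dx dθ Ω) (P : Measure Ω)
    (t : EuclideanSpace ℝ (Fin dx) → ℝ) : Measure Ω :=
  (ENNReal.ofReal (∫ ω, t (D.X ω) ∂P))⁻¹ • P.withDensity (fun ω => ENNReal.ofReal (t (D.X ω)))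

/-- `b` is an upper bound, in `[k, sup 𝒴₀]` and above `k₀`, for `R(k₁, X, θ)` among the units
with `k₀ ≤ Y*(0) ≤ R(k₁, X, θ)`, up to `P_T`-null sets. -/
def IsUpperEdge [MeasurableSpace Ω] (D : KinkDesign dx dθ Ω) (PT : Measure Ω)
    (θ : EuclideanSpace ℝ (Fin dθ)) (b : ℝ) : Prop :=
  D.k ≤ b ∧ b ≤ D.sHi 0 ∧ D.win 0 < b ∧
    PT {ω | b < D.W θ ω ∧ D.win 0 ≤ D.Ycf 0 ω ∧ D.Ycf 0 ω ≤ D.W θ ω} = 0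

/-- `ν` is (a version of) the regular conditional distribution of `R(k₁, X, θ)` given `Y*(0)`,
under the measure `PT`. -/
def IsCondLaw [MeasurableSpace Ω] (D : KinkDesign dx dθ Ω) (PT : Measure Ω)
    (θ : EuclideanSpace ℝ (Fin dθ)) (ν : Kernel ℝ ℝ) : Prop :=
  IsMarkovKernel ν ∧
    PT.map (fun ω => (D.Ycf 0 ω, D.W θ ω)) = (PT.map (D.Ycf 0)) ⊗ₘ ν

end KinkDesign

/-- The `τ`-quantile of a distribution on `ℝ`, for `τ ∈ (0, 1)`. -/
noncomputable def lawQuantile (μ : Measure ℝ) (τ : ℝ) : ℝ :=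
  sInf {w : ℝ | ENNReal.ofReal τ ≤ μ (Iic w)}

/-- The point `y + ρ e^{2πix}` of the complex plane. -/
noncomputable def circlePt (y ρ x : ℝ) : ℂ :=
  (y : ℂ) + (ρ : ℂ) * Complex.exp (2 * Real.pi * Complex.I * x)

/-- `F` is the analytic continuation of `h : [a, b] → ℝ` to (a neighborhood of) the closed
`ρ`-neighborhood of `[a, b]` in the complex plane. For `a < b` it is unique there. -/
def IsContinuation (a b ρ : ℝ) (h : ℝ → ℝ) (F : ℂ → ℂ) : Prop :=
  AnalyticOnNhd ℂ F (Metric.cthickening ρ ((fun y : ℝ => (y : ℂ)) '' Icc a b)) ∧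
    ∀ y ∈ Icc a b, F y = h y

/-- The analyticity condition on `[a, b]` for a function `f` and a family `(g τ)`, `τ ∈ (0, 1)`,
with smoothness constants `(ρ, β, δ)`. -/
def AnalyticityCondition (a b : ℝ) (f : ℝ → ℝ) (g : ℝ → ℝ → ℝ) (ρ β δ : ℝ) : Prop :=
  0 < ρ ∧ 0 ≤ β ∧ 0 ≤ δ ∧
  (∃ F : ℂ → ℂ, IsContinuation a b ρ f F ∧
    ∫ y in a..b, ∫ x in (0 : ℝ)..1, ‖F (circlePt y ρ x)‖ ≤ β * ∫ y in a..b, |f y|) ∧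
  ∃ G : ℝ → ℂ → ℂ, (∀ τ ∈ Ioo (0 : ℝ) 1, IsContinuation a b ρ (g τ) (G τ)) ∧
    (∀ τ ∈ Ioo (0 : ℝ) 1, ∀ y ∈ Icc a b, y ≤ g τ y →
      ∀ x ∈ Icc (0 : ℝ) 1, ‖G τ (circlePt y ρ x) - y‖ ≤ δ * ρ) ∧
    ∃ C : ℝ, ∀ τ ∈ Ioo (0 : ℝ) 1, ∀ y ∈ Icc a b, ∀ x ∈ Icc (0 : ℝ) 1,
      ‖G τ (circlePt y ρ x)‖ ≤ C

/-- `β` bounds the relative variation of `f` in the `ρ`-neighborhood at every point of `[a, b]`: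
the mean of `|f|` over the circle of radius `ρ` about `y` is at most `β |f(y)|`. -/
def RelativeVariationBound (a b : ℝ) (f : ℝ → ℝ) (ρ β : ℝ) : Prop :=
  ∃ F : ℂ → ℂ, IsContinuation a b ρ f F ∧
    ∀ y ∈ Icc a b, ∫ x in (0 : ℝ)..1, ‖F (circlePt y ρ x)‖ ≤ β * |f y|

/-- The function `y ↦ E_{P_T}[(R(k₁, X, θ) - a)^j | Y*(0) = y] f(y)`, where `ν` is the conditional
distribution of `R(k₁, X, θ)` given `Y*(0)`. -/
noncomputable def momentFun (ν : Kernel ℝ ℝ) (a : ℝ) (f : ℝ → ℝ) (j : ℕ) (y : ℝ) : ℝ :=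
  (∫ w, (w - a) ^ j ∂(ν y)) * f y

/-- The summand
`(1 / j!) D_y^{j-1} [E_{P_T}[(R(k₁, X, θ) - a)^j | Y*(0) = y] f(y)]` at `y = a`, for `j ≥ 1`,
with the derivatives taken in `[a, b]`. -/
noncomputable def momentTerm (ν : Kernel ℝ ℝ) (a b : ℝ) (f : ℝ → ℝ) (j : ℕ) : ℝ :=
  1 / (j.factorial : ℝ) * iteratedDerivWithin (j - 1) (momentFun ν a f j) (Icc a b) a

/-- The tail `∑_{j = l + 1}^∞` of the moment series. -/
noncomputable def momentTail (ν : Kernel ℝ ℝ) (a b : ℝ) (f : ℝ → ℝ) (l : ℕ) : ℝ :=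
  ∑' i : ℕ, momentTerm ν a b f (l + 1 + i)

/-- The moment series `∑_{j = 1}^∞`. -/
noncomputable def momentSeries (ν : Kernel ℝ ℝ) (a b : ℝ) (f : ℝ → ℝ) : ℝ :=
  ∑' i : ℕ, momentTerm ν a b f (1 + i)

/-- All the operations in the moment series make sense: the conditional moments are finite, the
functions are smooth on `[a, b]`, and the series converges. -/
structure MomentSeriesDefined (ν : Kernel ℝ ℝ) (a b : ℝ) (f : ℝ → ℝ) : Prop where
  integrable : ∀ j : ℕ, ∀ y ∈ Icc a b, Integrable (fun w : ℝ => (w - a) ^ j) (ν y)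
  smooth : ∀ j : ℕ, ContDiffOn ℝ ((⊤ : ℕ∞) : WithTop ℕ∞) (momentFun ν a f j) (Icc a b)
  summable : Summable (fun i : ℕ => momentTerm ν a b f (1 + i))

/-!
Fix `θ`, put `a = k₀`, `b` the upper edge, and let `g τ y` be the conditional quantiles of the
reversion `W = R(k₁, X, θ)` given `Y*(0) = y`. By the quantile transform
`E[(W - a)^j | Y*(0) = y] = ∫₀¹ (g τ y - a)^j dτ`, so the moment series is an average over `τ` of
Lagrange series of the single functions `g τ`.

*Range of the quantiles.* Single crossing and concavity give `W ≥ k ≥ a`, and the upper edge gives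
`W ≤ b` for the relevant units. Since the weight has conditional mean, and `Y*(0)` has density,
bounded away from zero, `g τ y ∈ [a, b]` for Lebesgue almost every `y ∈ [a, b]`, hence for all by
continuity (`KinkDesign.lawQuantile_mem`).

*Crossing.* Where `y ≤ g τ y`, the continuation maps the circle of radius `ρ` about `y` into the
disc of radius `δρ` about `y`, so Cauchy's estimate gives slope at most `δ < 1`. Hence
`{y ∈ [a, b] | y ≤ g τ y}` is an interval `[a, c τ]` with `g τ (c τ) = c τ`
(`ContractiveQuantiles.self_le_iff`).

*Lagrange's formula.* With `S_N(y) = D_z^N[(G z - y)^N F z]_{z = y} / N!`, the `j`-th term of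
Lagrange's series based at `y` has the `y`-derivative `S_j(y) - S_{j-1}(y)`, and it vanishes at the
fixed point `c`. So the sum of the first `N` terms at `a` is `∫_a^c F - ∫_a^c S_N`
(`lagrange_partial_sum`), and `|S_N(y)|` is at most `δ^N` times the mean of `|F|` over the circle
about `y` (`norm_diagDeriv_le`). Averaging over `τ` yields convergence, the sum `∫₀¹ ∫_a^{c τ} f`
(`ContractiveQuantiles.hasSum_momentTerm`), and the bound on the tails
(`ContractiveQuantiles.abs_momentTail_le`).

*Bunching probability.* The event `Y ∈ [k₀, k₁]` is `a ≤ Y*(0) ≤ W`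
(`KinkDesign.obs_mem_window_iff`). Conditioning on the quantile level, its probability is
`∫₀¹ P_T(a ≤ Y*(0) ≤ c τ) dτ`, and the envelope condition at each `y = c τ` bounds this by the two
series (`ContractiveQuantiles.compProd_above_diagonal_mem`).
-/

/-! ### The quantile transform -/

section Quantile

variable {μ : Measure ℝ} [IsProbabilityMeasure μ]

/-- The Galois connection between the quantile function and the distribution function. -/
theorem lawQuantile_le_iff {τ : ℝ} (hτ : τ ∈ Ioo (0 : ℝ) 1) (w : ℝ) :
    lawQuantile μ τ ≤ w ↔ ENNReal.ofReal τ ≤ μ (Iic w) := by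
  have key : ∀ v, ENNReal.ofReal τ ≤ μ (Iic v) ↔ τ ≤ cdf μ v := by
    intro v
    rw [cdf_eq_real, Measure.real, ENNReal.ofReal_le_iff_le_toReal (measure_ne_top _ _)]
  have hset : {v : ℝ | ENNReal.ofReal τ ≤ μ (Iic v)} = {v | τ ≤ cdf μ v} := by
    ext v; exact key v
  rw [key, lawQuantile, hset]
  have hbdd : BddBelow {v | τ ≤ cdf μ v} := by
    obtain ⟨x, hx⟩ := ((tendsto_cdf_atBot μ).eventually (gt_mem_nhds hτ.1)).exists
    refine ⟨x, fun v hv => ?_⟩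
    by_contra! h
    exact absurd ((hv : τ ≤ cdf μ v).trans (monotone_cdf μ h.le)) (not_le.2 hx)
  have hne : {v | τ ≤ cdf μ v}.Nonempty := by
    obtain ⟨x, hx⟩ := ((tendsto_cdf_atTop μ).eventually (lt_mem_nhds hτ.2)).exists
    exact ⟨x, hx.le⟩
  refine ⟨fun h => ?_, fun h => csInf_le hbdd h⟩
  have hw : ∀ v, w < v → τ ≤ cdf μ v := by
    intro v hv
    obtain ⟨u, hu, huv⟩ := exists_lt_of_csInf_lt hne (h.trans_lt hv)
    exact (hu : τ ≤ cdf μ u).trans (monotone_cdf μ huv.le)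
  have hlim : Filter.Tendsto (cdf μ) (nhdsWithin w (Ioi w)) (nhds (cdf μ w)) :=
    ((cdf μ).right_continuous w).mono Ioi_subset_Ici_self
  exact ge_of_tendsto hlim (eventually_mem_nhdsWithin.mono hw)

theorem monotoneOn_lawQuantile : MonotoneOn (lawQuantile μ) (Ioo 0 1) := by
  intro s hs τ hτ hst
  rw [lawQuantile_le_iff hs]
  exact (ENNReal.ofReal_le_ofReal hst).trans ((lawQuantile_le_iff hτ _).1 le_rfl)

theorem aemeasurable_lawQuantile :
    AEMeasurable (lawQuantile μ) (volume.restrict (Ioo 0 1)) :=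
  aemeasurable_restrict_of_monotoneOn measurableSet_Ioo monotoneOn_lawQuantile

/-- The quantile transform: the quantile function of `μ` at a uniform random level has law `μ`. -/
theorem map_lawQuantile : (volume.restrict (Ioo (0 : ℝ) 1)).map (lawQuantile μ) = μ := by
  have : IsProbabilityMeasure (volume.restrict (Ioo (0 : ℝ) 1)) := ⟨by simp⟩
  have : IsProbabilityMeasure ((volume.restrict (Ioo (0 : ℝ) 1)).map (lawQuantile μ)) :=
    Measure.isProbabilityMeasure_map aemeasurable_lawQuantile
  refine Measure.ext_of_Iic _ _ fun w => ?_
  rw [Measure.map_apply_of_aemeasurable aemeasurable_lawQuantile measurableSet_Iic,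
    Measure.restrict_apply' measurableSet_Ioo]
  have hset : lawQuantile μ ⁻¹' Iic w ∩ Ioo 0 1 = Iic (μ (Iic w)).toReal ∩ Ioo (0 : ℝ) 1 := by
    ext τ
    simp only [mem_inter_iff, mem_preimage, mem_Iic]
    refine and_congr_left fun hτ => ?_
    rw [lawQuantile_le_iff hτ, ENNReal.ofReal_le_iff_le_toReal (measure_ne_top _ _)]
  have h1 : (μ (Iic w)).toReal ≤ 1 := by
    exact measureReal_le_one (μ := μ) (s := Iic w)
  rw [hset, inter_comm, ← Measure.restrict_apply measurableSet_Ioo,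
    Measure.restrict_congr_set (Iio_ae_eq_Iic (α := ℝ)).symm,
    Measure.restrict_apply measurableSet_Ioo]
  have : Ioo (0 : ℝ) 1 ∩ Iio (μ (Iic w)).toReal = Ioo 0 (μ (Iic w)).toReal := by
    ext τ; simp only [mem_inter_iff, mem_Ioo, mem_Iio]
    constructor
    · rintro ⟨⟨h, -⟩, h'⟩; exact ⟨h, h'⟩
    · rintro ⟨h, h'⟩; exact ⟨⟨h, h'.trans_le h1⟩, h'⟩
  rw [this, Real.volume_Ioo, sub_zero, ENNReal.ofReal_toReal (measure_ne_top _ _)]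

theorem lawQuantile_mem_Icc {a b τ : ℝ} (hτ : τ ∈ Ioo (0 : ℝ) 1) (ha : μ (Iio a) = 0)
    (hb : μ (Ioi b) = 0) : lawQuantile μ τ ∈ Icc a b := by
  constructor
  · by_contra! h
    have h1 := (lawQuantile_le_iff (μ := μ) hτ _).1 le_rfl
    have h2 : μ (Iic (lawQuantile μ τ)) = 0 := measure_mono_null (Iic_subset_Iio.2 h) ha
    rw [h2, nonpos_iff_eq_zero, ENNReal.ofReal_eq_zero] at h1
    exact absurd hτ.1 (not_lt.2 h1)
  · rw [lawQuantile_le_iff hτ]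
    have : μ (Iic b) = 1 := by
      rw [← compl_Iic] at hb
      exact (prob_compl_eq_zero_iff measurableSet_Iic).1 hb
    rw [this]
    exact ENNReal.ofReal_le_one.2 hτ.2.le

theorem ae_mem_of_lawQuantile_mem {s : Set ℝ} (hs : MeasurableSet s)
    (h : ∀ τ ∈ Ioo (0 : ℝ) 1, lawQuantile μ τ ∈ s) : ∀ᵐ w ∂μ, w ∈ s := by
  rw [← map_lawQuantile (μ := μ), ae_map_iff aemeasurable_lawQuantile (p := (· ∈ s)) hs]
  exact (ae_restrict_iff' measurableSet_Ioo).2 (ae_of_all _ h)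

theorem integral_eq_integral_lawQuantile {φ : ℝ → ℝ} (hφ : Continuous φ) :
    ∫ w, φ w ∂μ = ∫ τ in Ioo (0 : ℝ) 1, φ (lawQuantile μ τ) := by
  conv_lhs => rw [← map_lawQuantile (μ := μ)]
  exact integral_map aemeasurable_lawQuantile hφ.aestronglyMeasurable

end Quantile

/-! ### Lagrange's inversion formula with remainder -/

section Lagrange

/-- The diagonal value `D_z^n [(G z - y)^j F z]` at `z = y`. The terms of Lagrange's series are
`diagDeriv G F j (j - 1) y / j!`. -/
noncomputable def diagDeriv (G F : ℂ → ℂ) (j n : ℕ) (y : ℂ) : ℂ :=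
  iteratedDeriv n (fun z => (G z - y) ^ j * F z) y

theorem AnalyticAt.sub_const_pow_mul {G F : ℂ → ℂ} {y : ℂ} (hG : AnalyticAt ℂ G y)
    (hF : AnalyticAt ℂ F y) (j : ℕ) (c : ℂ) : AnalyticAt ℂ (fun z => (G z - c) ^ j * F z) y :=
  ((hG.sub analyticAt_const).pow j).mul hF

theorem diagDeriv_succ {G F : ℂ → ℂ} {y : ℂ} (hG : AnalyticAt ℂ G y) (hF : AnalyticAt ℂ F y)
    (j n : ℕ) : diagDeriv G F (j + 1) n y =
      diagDeriv G (fun z => G z * F z) j n y - y * diagDeriv G F j n y := by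
  have h : (fun z => (G z - y) ^ (j + 1) * F z) =
      (fun z => (G z - y) ^ j * (G z * F z)) - fun z => y * ((G z - y) ^ j * F z) := by
    ext z; simp only [Pi.sub_apply]; ring
  have h1 := hG.sub_const_pow_mul hF j y
  have h2 : AnalyticAt ℂ (fun z => (G z - y) ^ j * (G z * F z)) y :=
    hG.sub_const_pow_mul (hG.mul hF) j y
  rw [diagDeriv, h, iteratedDeriv_sub h2.contDiffAt
    (show AnalyticAt ℂ (fun z => y * ((G z - y) ^ j * F z)) y from
      analyticAt_const.mul h1).contDiffAt, iteratedDeriv_const_mul _ h1.contDiffAt]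
  rfl

/-- Differentiating along the diagonal: the total derivative is the sum of the two partial
derivatives. -/
theorem hasDerivAt_diagDeriv {G : ℂ → ℂ} {y : ℂ} (hG : AnalyticAt ℂ G y) (n j : ℕ) :
    ∀ {F : ℂ → ℂ}, AnalyticAt ℂ F y → HasDerivAt (diagDeriv G F j n)
      (diagDeriv G F j (n + 1) y - j * diagDeriv G F (j - 1) n y) y := by
  induction j with
  | zero =>
    intro F hF
    have h : ∀ m, diagDeriv G F 0 m = iteratedDeriv m F := by
      intro m; ext w; simp [diagDeriv]
    have hd : DifferentiableAt ℂ (iteratedDeriv n F) y := by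
      rw [iteratedDeriv_eq_iterate]
      exact (hF.iterated_deriv n).differentiableAt
    simpa [h, iteratedDeriv_succ] using hd.hasDerivAt
  | succ j ih =>
    intro F hF
    have hGF : AnalyticAt ℂ (fun z => G z * F z) y := hG.mul hF
    have hev : diagDeriv G F (j + 1) n =ᶠ[nhds y]
        fun w => diagDeriv G (fun z => G z * F z) j n w - w * diagDeriv G F j n w := by
      filter_upwards [hG.eventually_analyticAt, hF.eventually_analyticAt] with w h1 h2
      exact diagDeriv_succ h1 h2 j n
    have hd := ((ih hGF).sub ((hasDerivAt_id y).mul (ih hF))).congr_of_eventuallyEq hev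
    refine hd.congr_deriv ?_
    rw [diagDeriv_succ hG hF j (n + 1)]
    rcases j with _ | j
    · simp; ring
    · have := diagDeriv_succ hG hF j n
      simp only [Nat.add_sub_cancel, id, Nat.cast_add, Nat.cast_one] at *
      rw [this]; ring

/-- `(G - c)^j F` vanishes to order `j` at a fixed point `c` of `G`. -/
theorem diagDeriv_eq_zero {G F : ℂ → ℂ} {c : ℂ} (hG : AnalyticAt ℂ G c) (hF : AnalyticAt ℂ F c)
    (hc : G c = c) {n j : ℕ} (hnj : n < j) : diagDeriv G F j n c = 0 := by
  refine (natCast_le_analyticOrderAt_iff_iteratedDeriv_eq_zero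
    (hG.sub_const_pow_mul hF j c)).1 ?_ n hnj
  have h0 : AnalyticAt ℂ (fun z => G z - c) c := hG.sub analyticAt_const
  have h1 : (1 : ℕ∞) ≤ analyticOrderAt (fun z => G z - c) c := by
    rw [Order.one_le_iff_ne_zero, Ne, h0.analyticOrderAt_eq_zero]
    simp [hc]
  have h2 : analyticOrderAt (fun z => (G z - c) ^ j * F z) c =
      j • analyticOrderAt (fun z => G z - c) c + analyticOrderAt F c := by
    rw [← analyticOrderAt_pow h0]
    exact analyticOrderAt_mul (h0.pow j) hF
  rw [h2]
  refine le_trans ?_ (self_le_add_right _ _)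
  simpa using nsmul_le_nsmul_right h1 j

/-- Lagrange's inversion formula with remainder: if `c` is a fixed point of `G`, the partial sums
of Lagrange's series at `a` equal `∫_a^c F` up to the integral over `[a, c]` of a diagonal
derivative. The derivative of the partial sum along the diagonal telescopes. -/
theorem lagrange_partial_sum {G F : ℂ → ℂ} {a c : ℝ} (hac : a ≤ c)
    (hG : ∀ y ∈ Icc a c, AnalyticAt ℂ G y) (hF : ∀ y ∈ Icc a c, AnalyticAt ℂ F y)
    (hc : G c = c) (N : ℕ) :
    ∑ j ∈ Finset.range N, diagDeriv G F (j + 1) j a / ((j + 1).factorial : ℂ) =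
      (∫ y in a..c, F y) - ∫ y in a..c, diagDeriv G F N N y / (N.factorial : ℂ) := by
  have hS : ∀ n, ∀ y ∈ Icc a c, HasDerivAt (fun y : ℝ => ∑ j ∈ Finset.range n,
      diagDeriv G F (j + 1) j y / ((j + 1).factorial : ℂ))
      (diagDeriv G F n n y / (n.factorial : ℂ) - F y) y := by
    intro n y hy
    have h1 : ∀ j ∈ Finset.range n, HasDerivAt (fun y : ℝ =>
        diagDeriv G F (j + 1) j y / ((j + 1).factorial : ℂ))
        (diagDeriv G F (j + 1) (j + 1) y / ((j + 1).factorial : ℂ) -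
          diagDeriv G F j j y / (j.factorial : ℂ)) y := by
      intro j _
      have h2 := ((hasDerivAt_diagDeriv (hG y hy) j (j + 1) (hF y hy)).comp_ofReal).div_const
        ((j + 1).factorial : ℂ)
      refine h2.congr_deriv ?_
      have h3 : (j.factorial : ℂ) ≠ 0 := by exact_mod_cast j.factorial_ne_zero
      have h4 : (j : ℂ) + 1 ≠ 0 := by exact_mod_cast j.succ_ne_zero
      rw [Nat.factorial_succ]
      push_cast
      field_simp
    refine (HasDerivAt.fun_sum h1).congr_deriv ?_
    -- The terms `diagDeriv G F j j / j!` telescope from `F` at `j = 0`.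
    rw [Finset.sum_range_sub (fun j => diagDeriv G F j j y / (j.factorial : ℂ))]
    simp [diagDeriv]
  have hcF : ContinuousOn (fun y : ℝ => F y) (Icc a c) := fun y hy =>
    ((hF y hy).continuousAt.comp Complex.continuous_ofReal.continuousAt).continuousWithinAt
  have hcS : ContinuousOn (fun y : ℝ => diagDeriv G F N N y / (N.factorial : ℂ)) (Icc a c) :=
    fun y hy => ((hasDerivAt_diagDeriv (hG y hy) N N
      (hF y hy)).comp_ofReal.continuousAt.div_const _).continuousWithinAt
  rw [← uIcc_of_le hac] at hcF hcS hS
  have hftc := intervalIntegral.integral_eq_sub_of_hasDerivAt (hS N)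
    (hcS.sub hcF).intervalIntegrable
  rw [intervalIntegral.integral_sub hcS.intervalIntegrable hcF.intervalIntegrable,
    Finset.sum_eq_zero (s := Finset.range N) (f := fun j =>
      diagDeriv G F (j + 1) j c / ((j + 1).factorial : ℂ))] at hftc
  · linear_combination hftc
  · intro j _
    rw [diagDeriv_eq_zero (hG c ⟨hac, le_rfl⟩) (hF c ⟨hac, le_rfl⟩) hc (Nat.lt_succ_self j),
      zero_div]

theorem circlePt_eq_circleMap (y ρ x : ℝ) : circlePt y ρ x = circleMap y ρ (2 * Real.pi * x) := by
  simp only [circlePt, circleMap]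
  push_cast
  ring_nf

theorem exists_circlePt_of_mem_sphere {y ρ : ℝ} {z : ℂ} (hρ : 0 < ρ)
    (hz : z ∈ Metric.sphere (y : ℂ) ρ) : ∃ x ∈ Icc (0 : ℝ) 1, circlePt y ρ x = z := by
  rw [← abs_of_pos hρ, ← image_circleMap_Ioc] at hz
  obtain ⟨θ, hθ, rfl⟩ := hz
  have hpi : 0 < 2 * Real.pi := by positivity
  refine ⟨θ / (2 * Real.pi), ⟨by have := hθ.1; positivity, (div_le_one hpi).2 hθ.2⟩, ?_⟩
  rw [circlePt_eq_circleMap, mul_div_cancel₀ _ hpi.ne']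

theorem circlePt_mem_sphere {y ρ : ℝ} (hρ : 0 < ρ) (x : ℝ) :
    circlePt y ρ x ∈ Metric.sphere (y : ℂ) ρ := by
  rw [circlePt_eq_circleMap]
  exact circleMap_mem_sphere _ hρ.le _

/-- Cauchy's estimate for the remainder in Lagrange's formula. -/
theorem norm_diagDeriv_le {G F : ℂ → ℂ} {y ρ δ : ℝ} (hρ : 0 < ρ)
    (hG : DifferentiableOn ℂ G (Metric.closedBall y ρ))
    (hF : DifferentiableOn ℂ F (Metric.closedBall y ρ))
    (hδ : ∀ x ∈ Icc (0 : ℝ) 1, ‖G (circlePt y ρ x) - y‖ ≤ δ * ρ) (N : ℕ) :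
    ‖diagDeriv G F N N y / (N.factorial : ℂ)‖ ≤
      δ ^ N * ∫ x in (0 : ℝ)..1, ‖F (circlePt y ρ x)‖ := by
  have hpi : 0 < 2 * Real.pi := by positivity
  have hδ' : ∀ z ∈ Metric.sphere (y : ℂ) ρ, ‖G z - y‖ ≤ δ * ρ := by
    intro z hz
    obtain ⟨x, hx, rfl⟩ := exists_circlePt_of_mem_sphere hρ hz
    exact hδ x hx
  have hcauchy := DifferentiableOn.circleIntegral_one_div_sub_center_pow_smul hρ N
    (((hG.sub_const (y : ℂ)).pow N).mul hF)
  have hcont : Continuous fun t : ℝ => F (circleMap y ρ t) :=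
    (hF.continuousOn.mono Metric.sphere_subset_closedBall).comp_continuous
      (continuous_circleMap _ _) fun t => circleMap_mem_sphere _ hρ.le _
  have hbound : ‖∮ z in C(y, ρ), (1 / (z - y) ^ (N + 1)) • ((G z - y) ^ N * F z)‖ ≤
      ∫ t in (0 : ℝ)..2 * Real.pi, δ ^ N * ‖F (circleMap y ρ t)‖ := by
    have hint : IntervalIntegrable (fun t : ℝ => δ ^ N * ‖F (circleMap y ρ t)‖) volume 0
        (2 * Real.pi) := (hcont.norm.const_mul _).intervalIntegrable _ _
    refine intervalIntegral.norm_integral_le_of_norm_le hpi.le (ae_of_all _ fun t _ => ?_) hint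
    have hz := circleMap_mem_sphere (y : ℂ) hρ.le t
    have h1 : ‖circleMap (y : ℂ) ρ t - y‖ = ρ := by simpa [dist_eq_norm] using hz
    simp only [deriv_circleMap, smul_eq_mul, norm_mul, norm_div, norm_pow, norm_one, h1,
      norm_circleMap_zero, Complex.norm_I, mul_one, abs_of_pos hρ]
    calc ρ * (1 / ρ ^ (N + 1) * (‖G (circleMap y ρ t) - y‖ ^ N * ‖F (circleMap y ρ t)‖))
        ≤ ρ * (1 / ρ ^ (N + 1) * ((δ * ρ) ^ N * ‖F (circleMap y ρ t)‖)) := by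
          gcongr; exact hδ' _ hz
      _ = δ ^ N * ‖F (circleMap y ρ t)‖ := by
          rw [mul_pow, pow_succ]; field_simp
  have hsub : ∫ x in (0 : ℝ)..1, ‖F (circlePt y ρ x)‖ =
      (2 * Real.pi)⁻¹ * ∫ t in (0 : ℝ)..2 * Real.pi, ‖F (circleMap y ρ t)‖ := by
    simp only [circlePt_eq_circleMap]
    rw [intervalIntegral.integral_comp_mul_left (fun t => ‖F (circleMap y ρ t)‖) hpi.ne']
    simp
  have heq : diagDeriv G F N N y / (N.factorial : ℂ) = (2 * Real.pi * Complex.I)⁻¹ *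
      ∮ z in C(y, ρ), (1 / (z - y) ^ (N + 1)) • ((G z - y) ^ N * F z) := by
    have h1 : (2 * Real.pi * Complex.I : ℂ) ≠ 0 := by
      simp [Real.pi_ne_zero]
    rw [eq_inv_mul_iff_mul_eq₀ h1]
    refine Eq.trans ?_ hcauchy.symm
    simp only [diagDeriv, smul_eq_mul]
    rw [mul_div_assoc', div_mul_eq_mul_div]
    rfl
  rw [heq, norm_mul, hsub]
  rw [intervalIntegral.integral_const_mul] at hbound
  have hn : ‖(2 * Real.pi * Complex.I : ℂ)⁻¹‖ = (2 * Real.pi)⁻¹ := by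
    simp [abs_of_pos Real.pi_pos]
  rw [hn, mul_left_comm]
  gcongr

end Lagrange

/-! ### Differentiation under the integral for analytic families -/

section IntegralOfAnalytic

variable {T : Type*} [MeasurableSpace T] {μ : Measure T}

/-- Derivatives on `[a, b]` of a family of analytic functions depend measurably on the parameter,
if the values on `[a, b]` do: they are limits of slopes along sequences in `[a, b]`. -/
theorem aemeasurable_iteratedDeriv {φ : T → ℂ → ℂ} {a b : ℝ} (hab : a < b)
    (hφ : ∀ᵐ t ∂μ, ∀ y ∈ Icc a b, AnalyticAt ℂ (φ t) (y : ℂ))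
    (hm : ∀ y ∈ Icc a b, AEMeasurable (fun t => φ t (y : ℂ)) μ) (n : ℕ) :
    ∀ y ∈ Icc a b, AEMeasurable (fun t => iteratedDeriv n (φ t) (y : ℂ)) μ := by
  induction n with
  | zero => simpa using hm
  | succ n ih =>
    intro y hy
    obtain ⟨m, hmem, hne⟩ : ∃ m ∈ Icc a b, m ≠ y := by
      by_cases h : y = a
      · exact ⟨b, right_mem_Icc.2 hab.le, by rw [h]; exact hab.ne'⟩
      · exact ⟨a, left_mem_Icc.2 hab.le, fun h' => h h'.symm⟩
    let u : ℕ → ℝ := fun k => y + (1 / ((k : ℝ) + 1)) * (m - y)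
    have hu : ∀ k, u k ∈ Icc a b := by
      intro k
      have h0 : (0 : ℝ) ≤ 1 / ((k : ℝ) + 1) := by positivity
      have h1 : 1 / ((k : ℝ) + 1) ≤ 1 := by
        rw [div_le_one (by positivity)]; simp
      have := (convex_Icc a b).add_smul_sub_mem hy hmem ⟨h0, h1⟩
      simpa [u] using this
    have hune : ∀ k, u k ≠ y := by
      intro k h
      have h0 : (1 / ((k : ℝ) + 1)) * (m - y) ≠ 0 :=
        mul_ne_zero (by positivity) (sub_ne_zero.2 hne)
      exact h0 (by simpa [u] using h)
    have hlim : Filter.Tendsto u Filter.atTop (nhds y) := by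
      have := (tendsto_one_div_add_atTop_nhds_zero_nat (𝕜 := ℝ)).mul_const (m - y)
      simpa [u] using this.const_add y
    have hlim' : Filter.Tendsto (fun k => ((u k : ℝ) : ℂ)) Filter.atTop
        (nhdsWithin (y : ℂ) {(y : ℂ)}ᶜ) := by
      refine tendsto_nhdsWithin_iff.2
        ⟨(Complex.continuous_ofReal.tendsto y).comp hlim, Filter.Eventually.of_forall fun k => ?_⟩
      simpa using hune k
    refine aemeasurable_of_tendsto_metrizable_ae (u := Filter.atTop)
      (f := fun k t => slope (iteratedDeriv n (φ t)) (y : ℂ) (u k)) (fun k => ?_) ?_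
    · simp only [slope_def_field]
      exact ((ih _ (hu k)).sub (ih y hy)).div_const _
    · filter_upwards [hφ] with t ht
      have hd : DifferentiableAt ℂ (iteratedDeriv n (φ t)) y := by
        rw [iteratedDeriv_eq_iterate]
        exact ((ht y hy).iterated_deriv n).differentiableAt
      rw [iteratedDeriv_succ]
      exact (hasDerivAt_iff_tendsto_slope.1 hd.hasDerivAt).comp hlim'

variable [IsFiniteMeasure μ]

/-- The integral of a uniformly bounded family of analytic functions has the integrated Taylor
series. -/
theorem hasSum_integral_taylor {φ : T → ℂ → ℂ} {c ρ M : ℝ} (hρ : 0 < ρ)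
    (hφ : ∀ᵐ t ∂μ, DifferentiableOn ℂ (φ t) (Metric.closedBall (c : ℂ) ρ))
    (hM : ∀ᵐ t ∂μ, ∀ z ∈ Metric.sphere (c : ℂ) ρ, ‖φ t z‖ ≤ M)
    (hm : ∀ n, AEMeasurable (fun t => iteratedDeriv n (φ t) (c : ℂ)) μ)
    {y : ℝ} (hy : |y - c| < ρ) :
    HasSum (fun n : ℕ => ((y - c : ℝ) : ℂ) ^ n *
      ((∫ t, iteratedDeriv n (φ t) (c : ℂ) ∂μ) / (n.factorial : ℂ))) (∫ t, φ t (y : ℂ) ∂μ) := by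
  have hbound : ∀ n, ∀ᵐ t ∂μ, ‖iteratedDeriv n (φ t) (c : ℂ)‖ ≤ n.factorial * M / ρ ^ n := by
    intro n
    filter_upwards [hφ, hM] with t h1 h2
    exact Complex.norm_iteratedDeriv_le_of_forall_mem_sphere_norm_le n hρ
      (h1.mono Metric.closure_ball_subset_closedBall).diffContOnCl h2
  have hint : ∀ n, Integrable (fun t => iteratedDeriv n (φ t) (c : ℂ)) μ := fun n =>
    Integrable.of_bound (hm n).aestronglyMeasurable _ (hbound n)
  let q : ℕ → T → ℂ := fun n t =>
    ((y - c : ℝ) : ℂ) ^ n / (n.factorial : ℂ) * iteratedDeriv n (φ t) (c : ℂ)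
  have hq : ∀ n, Integrable (q n) μ := fun n => (hint n).const_mul _
  have hqn : ∀ n, ∫ t, ‖q n t‖ ∂μ ≤ M * μ.real univ * (|y - c| / ρ) ^ n := by
    intro n
    have h1 : ∀ᵐ t ∂μ, ‖q n t‖ ≤ M * (|y - c| / ρ) ^ n := by
      filter_upwards [hbound n] with t ht
      have h2 : ‖q n t‖ = |y - c| ^ n / n.factorial * ‖iteratedDeriv n (φ t) (c : ℂ)‖ := by
        simp only [q, norm_mul, norm_div, norm_pow, Complex.norm_real, Real.norm_eq_abs,
          Complex.norm_natCast]
      rw [h2]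
      calc _ ≤ |y - c| ^ n / n.factorial * (n.factorial * M / ρ ^ n) := by gcongr
        _ = M * (|y - c| / ρ) ^ n := by
          have : (n.factorial : ℝ) ≠ 0 := by exact_mod_cast n.factorial_ne_zero
          rw [div_pow]; field_simp
    calc ∫ t, ‖q n t‖ ∂μ ≤ ∫ _, M * (|y - c| / ρ) ^ n ∂μ :=
          integral_mono_ae (hq n).norm (integrable_const _) h1
      _ = M * μ.real univ * (|y - c| / ρ) ^ n := by
          rw [integral_const, smul_eq_mul]; ring
  have hsum : Summable fun n => ∫ t, ‖q n t‖ ∂μ := by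
    refine Summable.of_nonneg_of_le (fun n => integral_nonneg fun t => norm_nonneg _) hqn
      (Summable.mul_left _ (summable_geometric_of_lt_one (by positivity) ?_))
    rwa [div_lt_one hρ]
  have hmain := hasSum_integral_of_summable_integral_norm hq hsum
  have h2 : ∫ t, ∑' n, q n t ∂μ = ∫ t, φ t (y : ℂ) ∂μ := by
    refine integral_congr_ae ?_
    filter_upwards [hφ] with t ht
    have hyb : (y : ℂ) ∈ Metric.ball (c : ℂ) ρ := by
      rw [Metric.mem_ball, dist_eq_norm, ← Complex.ofReal_sub, Complex.norm_real]
      exact hy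
    rw [← Complex.taylorSeries_eq_on_ball (ht.mono Metric.ball_subset_closedBall) hyb]
    refine tsum_congr fun n => ?_
    simp only [q, smul_eq_mul]
    push_cast
    ring
  rw [h2] at hmain
  refine HasSum.congr_fun hmain fun n => ?_
  rw [integral_const_mul]
  ring

/-- Differentiation under the integral sign, to all orders, for a uniformly bounded family of
analytic functions. -/
theorem analyticAt_re_integral {φ : T → ℂ → ℂ} {c ρ M : ℝ} (hρ : 0 < ρ)
    (hφ : ∀ᵐ t ∂μ, DifferentiableOn ℂ (φ t) (Metric.closedBall (c : ℂ) ρ))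
    (hM : ∀ᵐ t ∂μ, ∀ z ∈ Metric.sphere (c : ℂ) ρ, ‖φ t z‖ ≤ M)
    (hm : ∀ n, AEMeasurable (fun t => iteratedDeriv n (φ t) (c : ℂ)) μ) :
    AnalyticAt ℝ (fun y : ℝ => (∫ t, φ t (y : ℂ) ∂μ).re) c ∧
      ∀ n, iteratedDeriv n (fun y : ℝ => (∫ t, φ t (y : ℂ) ∂μ).re) c =
        (∫ t, iteratedDeriv n (φ t) (c : ℂ) ∂μ).re := by
  set A : ℕ → ℝ := fun n => (∫ t, iteratedDeriv n (φ t) (c : ℂ) ∂μ).re / n.factorial with hA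
  have hps : HasFPowerSeriesAt (fun y : ℝ => (∫ t, φ t (y : ℂ) ∂μ).re)
      (FormalMultilinearSeries.ofScalars ℝ A) c := by
    rw [hasFPowerSeriesAt_iff']
    filter_upwards [Metric.ball_mem_nhds c hρ] with y hy
    have h := Complex.hasSum_re (hasSum_integral_taylor hρ hφ hM hm (y := y)
      (by rwa [Metric.mem_ball, Real.dist_eq] at hy))
    refine HasSum.congr_fun h fun n => ?_
    rw [FormalMultilinearSeries.coeff_ofScalars, smul_eq_mul, ← Complex.ofReal_pow,
      Complex.re_ofReal_mul, ← Complex.ofReal_natCast, Complex.div_ofReal_re]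
  refine ⟨hps.analyticAt, fun n => ?_⟩
  have heq := hps.eq_formalMultilinearSeries hps.analyticAt.hasFPowerSeriesAt
  have hn := congrArg (fun p => p.coeff n) heq
  simp only [FormalMultilinearSeries.coeff_ofScalars, hA] at hn
  have : (n.factorial : ℝ) ≠ 0 := by exact_mod_cast n.factorial_ne_zero
  field_simp at hn
  exact hn.symm

end IntegralOfAnalytic

/-! ### Crossing of the diagonal -/

section Continuation

variable {a b ρ δ : ℝ} {h : ℝ → ℝ} {H : ℂ → ℂ}

theorem closedBall_subset_cthickening_Icc {y : ℝ} (hy : y ∈ Icc a b) :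
    Metric.closedBall (y : ℂ) ρ ⊆ Metric.cthickening ρ ((fun y : ℝ => (y : ℂ)) '' Icc a b) :=
  Metric.closedBall_subset_cthickening (mem_image_of_mem _ hy) ρ

theorem IsContinuation.differentiableOn_closedBall (hH : IsContinuation a b ρ h H) {y : ℝ}
    (hy : y ∈ Icc a b) : DifferentiableOn ℂ H (Metric.closedBall (y : ℂ) ρ) :=
  hH.1.differentiableOn.mono (closedBall_subset_cthickening_Icc hy)

theorem IsContinuation.analyticAt (hH : IsContinuation a b ρ h H) (hρ : 0 < ρ) {y : ℝ}
    (hy : y ∈ Icc a b) : AnalyticAt ℂ H (y : ℂ) :=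
  hH.1 _ (closedBall_subset_cthickening_Icc hy (Metric.mem_closedBall_self hρ.le))

theorem IsContinuation.continuousOn (hH : IsContinuation a b ρ h H) (hρ : 0 < ρ) :
    ContinuousOn h (Icc a b) := by
  have h1 : ContinuousOn (fun y : ℝ => (H y).re) (Icc a b) := fun y hy =>
    (Complex.continuous_re.continuousAt.comp ((hH.analyticAt hρ hy).continuousAt.comp
      Complex.continuous_ofReal.continuousAt)).continuousWithinAt
  exact h1.congr fun y hy => by simp [hH.2 y hy]

theorem IsContinuation.exists_bound (hH : IsContinuation a b ρ h H) :
    ∃ K, 0 ≤ K ∧ ∀ y ∈ Icc a b, ∀ z ∈ Metric.sphere (y : ℂ) ρ, ‖H z‖ ≤ K := by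
  have hc : IsCompact (Metric.cthickening ρ ((fun y : ℝ => (y : ℂ)) '' Icc a b)) :=
    (isCompact_Icc.image Complex.continuous_ofReal).cthickening
  obtain ⟨K, hK⟩ := hc.exists_bound_of_continuousOn hH.1.continuousOn
  exact ⟨max K 0, le_max_right _ _, fun y hy z hz => (hK z (closedBall_subset_cthickening_Icc hy
    (Metric.sphere_subset_closedBall hz))).trans (le_max_left _ _)⟩

/-- The last point of `[a, b]` at which `h` is not below the diagonal. -/
noncomputable def lastCrossing (a b : ℝ) (h : ℝ → ℝ) : ℝ := sSup {y ∈ Icc a b | y ≤ h y}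

/-- Under the contraction hypothesis the graph of `h` crosses the diagonal at most once, from above
to below: at a first return to the diagonal the left slope would be at least `1`, but Cauchy's
estimate bounds the derivative by `δ < 1`. -/
theorem IsContinuation.self_le_of_le (hH : IsContinuation a b ρ h H) (hρ : 0 < ρ) (hδ : δ < 1)
    (hctr : ∀ y ∈ Icc a b, y ≤ h y → ∀ x ∈ Icc (0 : ℝ) 1, ‖H (circlePt y ρ x) - y‖ ≤ δ * ρ)
    {x y : ℝ} (hx : x ∈ Icc a b) (hy : y ∈ Icc a b) (hxy : x ≤ y) (hle : y ≤ h y) : x ≤ h x := by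
  by_contra! hlt
  have hsub : Icc x y ⊆ Icc a b := Icc_subset_Icc hx.1 hy.2
  have hcl : IsClosed {s ∈ Icc x y | s ≤ h s} :=
    isClosed_Icc.isClosed_le continuousOn_id ((hH.continuousOn hρ).mono hsub)
  have hbdd : BddBelow {s ∈ Icc x y | s ≤ h s} := ⟨x, fun s hs => hs.1.1⟩
  have hc := hcl.csInf_mem ⟨y, right_mem_Icc.2 hxy, hle⟩ hbdd
  set c := sInf {s ∈ Icc x y | s ≤ h s}
  have hcab := hsub hc.1
  have hxc : x < c := lt_of_le_of_ne hc.1.1 fun he => by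
    rw [← he] at hc; exact absurd hc.2 (not_le.2 hlt)
  have hbelow : ∀ s ∈ Ioo x c, h s < s := fun s hs => by
    by_contra! hs'
    exact absurd (csInf_le hbdd ⟨⟨hs.1.le, hs.2.le.trans hc.1.2⟩, hs'⟩) (not_le.2 hs.2)
  have hderiv : ‖deriv H c‖ ≤ δ := by
    have h1 := Complex.norm_deriv_le_of_forall_mem_sphere_norm_le (f := fun z => H z - c)
      (C := δ * ρ) hρ (((hH.differentiableOn_closedBall hcab).sub_const (c : ℂ)).mono
        Metric.closure_ball_subset_closedBall).diffContOnCl (fun z hz => by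
          obtain ⟨s, hs, rfl⟩ := exists_circlePt_of_mem_sphere hρ hz
          exact hctr c hcab hc.2 s hs)
    rwa [deriv_sub_const, mul_div_cancel_right₀ _ hρ.ne'] at h1
  have hd : HasDerivAt (fun s : ℝ => H s) (deriv H c) c :=
    (hH.analyticAt hρ hcab).differentiableAt.hasDerivAt.comp_ofReal
  have hlim := ((hasDerivAt_iff_tendsto_slope.1 hd).mono_left
    (nhdsWithin_mono c (s := Iio c) fun s hs => ne_of_lt hs)).norm
  have hge : 1 ≤ ‖deriv H c‖ := by
    refine ge_of_tendsto hlim ?_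
    filter_upwards [Ioo_mem_nhdsLT hxc] with s hs
    have hs' : s ∈ Icc a b := ⟨hx.1.trans hs.1.le, hs.2.le.trans hcab.2⟩
    have h2 := hbelow s hs
    rw [slope_def_module, hH.2 s hs', hH.2 c hcab, ← Complex.ofReal_sub, norm_smul,
      Complex.norm_real, norm_inv, Real.norm_eq_abs, Real.norm_eq_abs, abs_of_neg (sub_neg.2 hs.2),
      abs_of_neg (sub_neg.2 (h2.trans (hs.2.trans_le hc.2))), inv_mul_eq_div,
      one_le_div (by linarith [hs.2])]
    linarith [hc.2]
  linarith

theorem lastCrossing_mem (hH : IsContinuation a b ρ h H) (hρ : 0 < ρ) (hab : a ≤ b)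
    (ha : a ≤ h a) : lastCrossing a b h ∈ {y ∈ Icc a b | y ≤ h y} :=
  (isClosed_Icc.isClosed_le continuousOn_id (hH.continuousOn hρ)).csSup_mem
    ⟨a, left_mem_Icc.2 hab, ha⟩ ⟨b, fun _ hy => hy.1.2⟩

theorem IsContinuation.self_le_iff (hH : IsContinuation a b ρ h H) (hρ : 0 < ρ) (hδ : δ < 1)
    (hctr : ∀ y ∈ Icc a b, y ≤ h y → ∀ x ∈ Icc (0 : ℝ) 1, ‖H (circlePt y ρ x) - y‖ ≤ δ * ρ)
    (ha : a ≤ h a) {y : ℝ} (hy : y ∈ Icc a b) : y ≤ h y ↔ y ≤ lastCrossing a b h := by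
  have hc := lastCrossing_mem hH hρ (hy.1.trans hy.2) ha
  exact ⟨fun hle => le_csSup ⟨b, fun _ hz => hz.1.2⟩ ⟨hy, hle⟩,
    fun hle => hH.self_le_of_le hρ hδ hctr hy hc.1 hle hc.2⟩

theorem lastCrossing_isFixedPt (hH : IsContinuation a b ρ h H) (hρ : 0 < ρ) (hab : a ≤ b)
    (ha : a ≤ h a) (hb : h b ≤ b) : h (lastCrossing a b h) = lastCrossing a b h := by
  have hc := lastCrossing_mem hH hρ hab ha
  refine le_antisymm ?_ hc.2
  rcases hc.1.2.eq_or_lt with he | hlt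
  · rw [he]; exact hb
  · have hlim : Filter.Tendsto h (nhdsWithin (lastCrossing a b h) (Ioc (lastCrossing a b h) b))
        (nhds (h (lastCrossing a b h))) :=
      (hH.continuousOn hρ _ hc.1).mono (Ioc_subset_Icc_self.trans (Icc_subset_Icc_left hc.1.1))
    rw [nhdsWithin_Ioc_eq_nhdsGT hlt] at hlim
    refine le_of_tendsto_of_tendsto hlim
      ((continuous_id.tendsto _).mono_left nhdsWithin_le_nhds) ?_
    filter_upwards [Ioc_mem_nhdsGT hlt] with s hs
    by_contra! hs'
    exact absurd (le_csSup ⟨b, fun _ hz => hz.1.2⟩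
      (⟨⟨hc.1.1.trans hs.1.le, hs.2⟩, hs'.le⟩ : s ∈ {y ∈ Icc a b | y ≤ h y})) (not_le.2 hs.1)

end Continuation

/-! ### The moment series -/

/-- The conditional quantiles of the kernel `ν` take values in `[a, b]` and have the uniformly
bounded continuations `G τ`, which contract the circles of radius `ρ` towards their centres `y`
wherever the quantile is at least `y`. -/
structure ContractiveQuantiles (a b ρ δ C : ℝ) (ν : Kernel ℝ ℝ) (G : ℝ → ℂ → ℂ) : Prop where
  lt : a < b
  rho_pos : 0 < ρ
  delta_nonneg : 0 ≤ δ
  delta_lt : δ < 1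
  cont : ∀ τ ∈ Ioo (0 : ℝ) 1, IsContinuation a b ρ (fun y => lawQuantile (ν y) τ) (G τ)
  mem : ∀ τ ∈ Ioo (0 : ℝ) 1, ∀ y ∈ Icc a b, lawQuantile (ν y) τ ∈ Icc a b
  contr : ∀ τ ∈ Ioo (0 : ℝ) 1, ∀ y ∈ Icc a b, y ≤ lawQuantile (ν y) τ →
    ∀ x ∈ Icc (0 : ℝ) 1, ‖G τ (circlePt y ρ x) - y‖ ≤ δ * ρ
  bdd : ∀ τ ∈ Ioo (0 : ℝ) 1, ∀ y ∈ Icc a b, ∀ x ∈ Icc (0 : ℝ) 1, ‖G τ (circlePt y ρ x)‖ ≤ C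

/-- The point at which the `τ`-quantile of `ν y` crosses the diagonal. -/
noncomputable def quantileCrossing (ν : Kernel ℝ ℝ) (a b τ : ℝ) : ℝ :=
  lastCrossing a b (fun y => lawQuantile (ν y) τ)

/-- The mean over the level `τ` of the integral of `f` up to the crossing point. -/
noncomputable def crossingIntegral (ν : Kernel ℝ ℝ) (a b : ℝ) (f : ℝ → ℝ) : ℝ :=
  ∫ τ in Ioo (0 : ℝ) 1, ∫ y in a..quantileCrossing ν a b τ, f y

namespace ContractiveQuantiles

variable {a b ρ δ C : ℝ} {ν : Kernel ℝ ℝ} {G : ℝ → ℂ → ℂ}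

theorem crossing_mem (hq : ContractiveQuantiles a b ρ δ C ν G) {τ : ℝ} (hτ : τ ∈ Ioo (0 : ℝ) 1) :
    quantileCrossing ν a b τ ∈ Icc a b :=
  (lastCrossing_mem (hq.cont τ hτ) hq.rho_pos hq.lt.le
    (hq.mem τ hτ a (left_mem_Icc.2 hq.lt.le)).1).1

theorem self_le_iff (hq : ContractiveQuantiles a b ρ δ C ν G) {τ y : ℝ} (hτ : τ ∈ Ioo (0 : ℝ) 1)
    (hy : y ∈ Icc a b) : y ≤ lawQuantile (ν y) τ ↔ y ≤ quantileCrossing ν a b τ :=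
  (hq.cont τ hτ).self_le_iff hq.rho_pos hq.delta_lt (hq.contr τ hτ)
    (hq.mem τ hτ a (left_mem_Icc.2 hq.lt.le)).1 hy

theorem continuation_crossing (hq : ContractiveQuantiles a b ρ δ C ν G) {τ : ℝ}
    (hτ : τ ∈ Ioo (0 : ℝ) 1) :
    G τ (quantileCrossing ν a b τ) = quantileCrossing ν a b τ := by
  rw [(hq.cont τ hτ).2 _ (hq.crossing_mem hτ)]
  exact congrArg _ (lastCrossing_isFixedPt (hq.cont τ hτ) hq.rho_pos hq.lt.le
    (hq.mem τ hτ a (left_mem_Icc.2 hq.lt.le)).1 (hq.mem τ hτ b (right_mem_Icc.2 hq.lt.le)).2)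

variable [IsMarkovKernel ν]

theorem monotoneOn_crossing (hq : ContractiveQuantiles a b ρ δ C ν G) :
    MonotoneOn (quantileCrossing ν a b) (Ioo 0 1) := by
  intro s hs τ hτ hst
  have hc := hq.crossing_mem hs
  rw [← hq.self_le_iff hτ hc]
  exact ((hq.self_le_iff hs hc).2 le_rfl).trans (monotoneOn_lawQuantile hs hτ hst)

theorem aemeasurable_crossing (hq : ContractiveQuantiles a b ρ δ C ν G) :
    AEMeasurable (quantileCrossing ν a b) (volume.restrict (Ioo 0 1)) :=
  aemeasurable_restrict_of_monotoneOn measurableSet_Ioo hq.monotoneOn_crossing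

theorem integrable_crossing (hq : ContractiveQuantiles a b ρ δ C ν G) {f : ℝ → ℝ}
    (hf : ContinuousOn f (Icc a b)) :
    Integrable (fun τ => ∫ y in a..quantileCrossing ν a b τ, f y) (volume.restrict (Ioo 0 1)) := by
  obtain ⟨K, hK⟩ := isCompact_Icc.exists_bound_of_continuousOn hf
  have hK0 : 0 ≤ K := (norm_nonneg _).trans (hK a (left_mem_Icc.2 hq.lt.le))
  -- Cutting `f` off outside `[a, b]` makes its primitive continuous on the whole line.
  have hcont : Continuous fun x => ∫ y in a..x, (Icc a b).indicator f y :=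
    intervalIntegral.continuous_primitive (fun _ _ =>
      ((integrable_indicator_iff measurableSet_Icc).2
        hf.integrableOn_Icc).intervalIntegrable) a
  have heq : ∀ τ ∈ Ioo (0 : ℝ) 1, ∫ y in a..quantileCrossing ν a b τ, (Icc a b).indicator f y =
      ∫ y in a..quantileCrossing ν a b τ, f y := by
    intro τ hτ
    have hc := hq.crossing_mem hτ
    refine intervalIntegral.integral_congr fun y hy => ?_
    rw [uIcc_of_le hc.1] at hy
    exact indicator_of_mem (Icc_subset_Icc_right hc.2 hy) f
  refine Integrable.of_bound (C := K * (b - a)) ?_ ?_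
  · refine ((hcont.measurable.comp_aemeasurable hq.aemeasurable_crossing).congr ?_
      ).aestronglyMeasurable
    exact (ae_restrict_iff' measurableSet_Ioo).2 (ae_of_all _ heq)
  · refine (ae_restrict_iff' measurableSet_Ioo).2 (ae_of_all _ fun τ hτ => ?_)
    have hc := hq.crossing_mem hτ
    refine (intervalIntegral.norm_integral_le_of_norm_le_const (C := K) fun y hy => ?_).trans ?_
    · rw [uIoc_of_le hc.1] at hy
      exact hK y ⟨hy.1.le, hy.2.trans hc.2⟩
    · rw [abs_of_nonneg (sub_nonneg.2 hc.1)]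
      gcongr
      exact hc.2

theorem ae_mem_Icc (hq : ContractiveQuantiles a b ρ δ C ν G) {y : ℝ} (hy : y ∈ Icc a b) :
    ∀ᵐ w ∂ν y, w ∈ Icc a b :=
  ae_mem_of_lawQuantile_mem measurableSet_Icc fun τ hτ => hq.mem τ hτ y hy

/-- Smoothness of the weighted conditional moments, and the formula for their derivatives, by
differentiation under the integral over the quantile level. -/
theorem momentFun_smooth (hq : ContractiveQuantiles a b ρ δ C ν G) {f : ℝ → ℝ} {F : ℂ → ℂ}
    (hF : IsContinuation a b ρ f F) (j : ℕ) :
    ContDiffOn ℝ ((⊤ : ℕ∞) : WithTop ℕ∞) (momentFun ν a f j) (Icc a b) ∧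
    ∀ n, (Integrable (fun τ => iteratedDeriv n (fun z => (G τ z - a) ^ j * F z) (a : ℂ))
        (volume.restrict (Ioo (0 : ℝ) 1))) ∧
      iteratedDerivWithin n (momentFun ν a f j) (Icc a b) a =
        (∫ τ in Ioo (0 : ℝ) 1, iteratedDeriv n (fun z => (G τ z - a) ^ j * F z) (a : ℂ)).re := by
  obtain ⟨K, hK0, hK⟩ := hF.exists_bound
  set μ := volume.restrict (Ioo (0 : ℝ) 1)
  have hae : ∀ {p : ℝ → Prop}, (∀ τ ∈ Ioo (0 : ℝ) 1, p τ) → ∀ᵐ τ ∂μ, p τ := fun h =>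
    (ae_restrict_iff' measurableSet_Ioo).2 (ae_of_all _ h)
  let φ : ℝ → ℂ → ℂ := fun τ z => (G τ z - a) ^ j * F z
  have hval : ∀ τ ∈ Ioo (0 : ℝ) 1, ∀ y ∈ Icc a b,
      φ τ y = (((lawQuantile (ν y) τ - a) ^ j * f y : ℝ) : ℂ) := by
    intro τ hτ y hy
    simp only [φ, (hq.cont τ hτ).2 y hy, hF.2 y hy]
    push_cast; rfl
  have hdiff : ∀ y ∈ Icc a b, ∀ᵐ τ ∂μ, DifferentiableOn ℂ (φ τ) (Metric.closedBall (y : ℂ) ρ) :=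
    fun y hy => hae fun τ hτ => ((((hq.cont τ hτ).differentiableOn_closedBall hy).sub_const
      (a : ℂ)).pow j).mul (hF.differentiableOn_closedBall hy)
  have hbound : ∀ y ∈ Icc a b, ∀ᵐ τ ∂μ, ∀ z ∈ Metric.sphere (y : ℂ) ρ,
      ‖φ τ z‖ ≤ (C + |a|) ^ j * K := by
    refine fun y hy => hae fun τ hτ z hz => ?_
    obtain ⟨x, hx, rfl⟩ := exists_circlePt_of_mem_sphere hq.rho_pos hz
    simp only [φ, norm_mul, norm_pow]
    have h1 : ‖G τ (circlePt y ρ x) - a‖ ≤ C + |a| := by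
      refine (norm_sub_le _ _).trans (add_le_add (hq.bdd τ hτ y hy x hx) ?_)
      simp
    exact mul_le_mul (pow_le_pow_left₀ (norm_nonneg _) h1 j) (hK y hy _ hz) (norm_nonneg _)
      (pow_nonneg ((norm_nonneg _).trans h1) j)
  have hmeas : ∀ y ∈ Icc a b, AEMeasurable (fun τ => φ τ (y : ℂ)) μ := by
    intro y hy
    refine AEMeasurable.congr (f := fun τ => (((lawQuantile (ν y) τ - a) ^ j * f y : ℝ) : ℂ)) ?_
      (hae fun τ hτ => (hval τ hτ y hy).symm)
    exact Complex.measurable_ofReal.comp_aemeasurable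
      (((aemeasurable_lawQuantile.sub_const a).pow_const j).mul_const (f y))
  have hmeas' : ∀ n, ∀ y ∈ Icc a b, AEMeasurable (fun τ => iteratedDeriv n (φ τ) (y : ℂ)) μ :=
    aemeasurable_iteratedDeriv hq.lt (hae fun τ hτ y hy =>
      ((hq.cont τ hτ).analyticAt hq.rho_pos hy).sub_const_pow_mul
        (hF.analyticAt hq.rho_pos hy) j a) hmeas
  have han := fun y (hy : y ∈ Icc a b) => analyticAt_re_integral hq.rho_pos (hdiff y hy)
    (hbound y hy) (fun n => hmeas' n y hy)
  have hmom : EqOn (momentFun ν a f j) (fun y : ℝ => (∫ τ, φ τ (y : ℂ) ∂μ).re) (Icc a b) := by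
    intro y hy
    have h1 : ∫ τ, φ τ (y : ℂ) ∂μ =
        ∫ τ, (((lawQuantile (ν y) τ - a) ^ j * f y : ℝ) : ℂ) ∂μ :=
      integral_congr_ae (hae fun τ hτ => hval τ hτ y hy)
    simp only [momentFun, h1]
    rw [integral_complex_ofReal, Complex.ofReal_re, integral_mul_const,
      integral_eq_integral_lawQuantile (φ := fun w => (w - a) ^ j) (by fun_prop)]
  have ha := left_mem_Icc.2 hq.lt.le
  refine ⟨ContDiffOn.congr (fun y hy => (han y hy).1.contDiffAt.contDiffWithinAt) hmom,
    fun n => ⟨?_, ?_⟩⟩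
  · refine Integrable.of_bound (hmeas' n a ha).aestronglyMeasurable
      (n.factorial * ((C + |a|) ^ j * K) / ρ ^ n) ?_
    filter_upwards [hdiff a ha, hbound a ha] with τ h1 h2
    exact Complex.norm_iteratedDeriv_le_of_forall_mem_sphere_norm_le n hq.rho_pos
      (h1.mono Metric.closure_ball_subset_closedBall).diffContOnCl h2
  · rw [iteratedDerivWithin_congr hmom ha, iteratedDerivWithin_eq_iteratedDeriv
      (uniqueDiffOn_Icc hq.lt) (han a ha).1.contDiffAt ha, (han a ha).2 n]

theorem momentTerm_eq (hq : ContractiveQuantiles a b ρ δ C ν G) {f : ℝ → ℝ} {F : ℂ → ℂ}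
    (hF : IsContinuation a b ρ f F) (j : ℕ) :
    Integrable (fun τ => diagDeriv (G τ) F (j + 1) j a / ((j + 1).factorial : ℂ))
      (volume.restrict (Ioo (0 : ℝ) 1)) ∧
    momentTerm ν a b f (1 + j) =
      (∫ τ in Ioo (0 : ℝ) 1, diagDeriv (G τ) F (j + 1) j a / ((j + 1).factorial : ℂ)).re := by
  obtain ⟨hint, heq⟩ := (hq.momentFun_smooth hF (j + 1)).2 j
  refine ⟨hint.div_const _, ?_⟩
  rw [add_comm 1 j, momentTerm, Nat.add_sub_cancel, heq, integral_div, ← Complex.ofReal_natCast,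
    Complex.div_ofReal_re, one_div, inv_mul_eq_div]
  rfl

/-- The error of the partial sums of the moment series, by Lagrange's formula at each quantile
level. -/
theorem abs_sum_momentTerm_sub_le (hq : ContractiveQuantiles a b ρ δ C ν G) {f κ : ℝ → ℝ}
    {F : ℂ → ℂ} (hF : IsContinuation a b ρ f F) (hκ : ContinuousOn κ (Icc a b))
    (hFκ : ∀ y ∈ Icc a b, ∫ x in (0 : ℝ)..1, ‖F (circlePt y ρ x)‖ ≤ κ y) (N : ℕ) :
    |∑ j ∈ Finset.range N, momentTerm ν a b f (1 + j) - crossingIntegral ν a b f| ≤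
      δ ^ N * crossingIntegral ν a b κ := by
  have hterm := fun j => hq.momentTerm_eq hF j
  have hfc := hF.continuousOn hq.rho_pos
  have hsum : ∑ j ∈ Finset.range N, momentTerm ν a b f (1 + j) = (∫ τ in Ioo (0 : ℝ) 1,
      ∑ j ∈ Finset.range N, diagDeriv (G τ) F (j + 1) j a / ((j + 1).factorial : ℂ)).re := by
    rw [integral_finsetSum _ fun j _ => (hterm j).1, Complex.re_sum]
    exact Finset.sum_congr rfl fun j _ => (hterm j).2
  have hcross : crossingIntegral ν a b f = (∫ τ in Ioo (0 : ℝ) 1,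
      ((∫ y in a..quantileCrossing ν a b τ, f y : ℝ) : ℂ)).re := by
    rw [integral_complex_ofReal, Complex.ofReal_re, crossingIntegral]
  have hint : Integrable (fun τ => ((∫ y in a..quantileCrossing ν a b τ, f y : ℝ) : ℂ))
      (volume.restrict (Ioo (0 : ℝ) 1)) := (hq.integrable_crossing hfc).ofReal
  rw [hsum, hcross, ← Complex.sub_re, ← integral_sub
    (integrable_finsetSum _ fun j _ => (hterm j).1) hint]
  refine (Complex.abs_re_le_norm _).trans ?_
  rw [crossingIntegral, ← integral_const_mul]
  refine norm_integral_le_of_norm_le ((hq.integrable_crossing hκ).const_mul _)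
    ((ae_restrict_iff' measurableSet_Ioo).2 (ae_of_all _ fun τ hτ => ?_))
  have hc := hq.crossing_mem hτ
  set c := quantileCrossing ν a b τ
  have hsub : Icc a c ⊆ Icc a b := Icc_subset_Icc_right hc.2
  have hF' : ∫ y in a..c, F y = ((∫ y in a..c, f y : ℝ) : ℂ) := by
    rw [← intervalIntegral.integral_ofReal]
    refine intervalIntegral.integral_congr fun y hy => ?_
    rw [uIcc_of_le hc.1] at hy
    exact hF.2 y (hsub hy)
  rw [lagrange_partial_sum hc.1 (fun y hy => (hq.cont τ hτ).analyticAt hq.rho_pos (hsub hy))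
    (fun y hy => hF.analyticAt hq.rho_pos (hsub hy)) (hq.continuation_crossing hτ) N, hF',
    sub_sub_cancel_left, norm_neg, ← intervalIntegral.integral_const_mul]
  refine intervalIntegral.norm_integral_le_of_norm_le hc.1 (ae_of_all _ fun y hy => ?_) ?_
  · have hy' : y ∈ Icc a b := hsub (Ioc_subset_Icc_self hy)
    refine (norm_diagDeriv_le hq.rho_pos ((hq.cont τ hτ).differentiableOn_closedBall hy')
      (hF.differentiableOn_closedBall hy')
      (hq.contr τ hτ y hy' ((hq.self_le_iff hτ hy').2 hy.2)) N).trans ?_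
    exact mul_le_mul_of_nonneg_left (hFκ y hy') (pow_nonneg hq.delta_nonneg N)
  · refine ContinuousOn.intervalIntegrable ?_
    rw [uIcc_of_le hc.1]
    exact continuousOn_const.mul (hκ.mono hsub)

/-- The moment series converges geometrically, and its sum is the integral of `f` up to the
crossing point, averaged over the quantile level. -/
theorem hasSum_momentTerm (hq : ContractiveQuantiles a b ρ δ C ν G) {f : ℝ → ℝ} {F : ℂ → ℂ}
    (hF : IsContinuation a b ρ f F) :
    HasSum (fun j => momentTerm ν a b f (1 + j)) (crossingIntegral ν a b f) := by
  obtain ⟨K, hK0, hK⟩ := hF.exists_bound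
  have hFκ : ∀ y ∈ Icc a b, ∫ x in (0 : ℝ)..1, ‖F (circlePt y ρ x)‖ ≤ (fun _ => K) y := by
    intro y hy
    have h1 : ‖∫ x in (0 : ℝ)..1, ‖F (circlePt y ρ x)‖‖ ≤ K * |1 - 0| :=
      intervalIntegral.norm_integral_le_of_norm_le_const fun x _ => by
        rw [norm_norm]; exact hK y hy _ (circlePt_mem_sphere hq.rho_pos x)
    exact (le_abs_self _).trans (by simpa using h1)
  have hpart := hq.abs_sum_momentTerm_sub_le hF continuousOn_const hFκ
  set J := crossingIntegral ν a b fun _ => K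
  have hgeom : Summable fun N : ℕ => δ ^ N * (2 * J) :=
    (summable_geometric_of_lt_one hq.delta_nonneg hq.delta_lt).mul_right _
  have hJ : 0 ≤ J := by simpa using (abs_nonneg _).trans (hpart 0)
  have hsum : Summable fun j => momentTerm ν a b f (1 + j) := by
    refine Summable.of_norm_bounded hgeom fun N => ?_
    -- Each term is the difference of two consecutive partial sums.
    have h1 := abs_le.1 (hpart N)
    have h2 := abs_le.1 (hpart (N + 1))
    have h3 : δ ^ (N + 1) * J ≤ δ ^ N * J := by
      gcongr ?_ * J
      exact pow_le_pow_of_le_one hq.delta_nonneg hq.delta_lt.le N.le_succ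
    rw [Finset.sum_range_succ] at h2
    rw [Real.norm_eq_abs, abs_le]
    constructor <;> nlinarith [h1.1, h1.2, h2.1, h2.2]
  have hlim : Filter.Tendsto (fun N => ∑ j ∈ Finset.range N, momentTerm ν a b f (1 + j))
      Filter.atTop (nhds (crossingIntegral ν a b f)) := by
    rw [tendsto_iff_dist_tendsto_zero]
    refine squeeze_zero (fun _ => dist_nonneg) hpart ?_
    simpa using (tendsto_pow_atTop_nhds_zero_of_lt_one hq.delta_nonneg hq.delta_lt).mul_const J
  rw [← tendsto_nhds_unique hsum.hasSum.tendsto_sum_nat hlim]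
  exact hsum.hasSum

theorem momentSeriesDefined (hq : ContractiveQuantiles a b ρ δ C ν G) {f : ℝ → ℝ} {F : ℂ → ℂ}
    (hF : IsContinuation a b ρ f F) : MomentSeriesDefined ν a b f where
  integrable j y hy := by
    refine Integrable.of_bound (by fun_prop) ((b - a) ^ j) ?_
    filter_upwards [hq.ae_mem_Icc hy] with w hw
    rw [norm_pow, Real.norm_eq_abs, abs_of_nonneg (sub_nonneg.2 hw.1)]
    exact pow_le_pow_left₀ (sub_nonneg.2 hw.1) (by linarith [hw.2]) j
  smooth j := (hq.momentFun_smooth hF j).1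
  summable := (hq.hasSum_momentTerm hF).summable

theorem abs_momentTail_le (hq : ContractiveQuantiles a b ρ δ C ν G) {f : ℝ → ℝ} {β : ℝ}
    (hf : ∀ y ∈ Icc a b, 0 ≤ f y) (hvar : RelativeVariationBound a b f ρ β) (l : ℕ) :
    |momentTail ν a b f l| ≤ β * δ ^ l * momentSeries ν a b f := by
  obtain ⟨F, hF, hFβ⟩ := hvar
  have hs := hq.hasSum_momentTerm hF
  have hpart := hq.abs_sum_momentTerm_sub_le hF (κ := fun y => β * f y)
    (continuousOn_const.mul (hF.continuousOn hq.rho_pos))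
    (fun y hy => by simpa [abs_of_nonneg (hf y hy)] using hFβ y hy) l
  have hser : momentSeries ν a b f = crossingIntegral ν a b f := hs.tsum_eq
  have htail : ∑ j ∈ Finset.range l, momentTerm ν a b f (1 + j) + momentTail ν a b f l =
      momentSeries ν a b f := by
    rw [momentSeries, ← hs.summable.sum_add_tsum_nat_add l, momentTail]
    congr 2
    ext i
    congr 1
    ring
  have hβ : crossingIntegral ν a b (fun y => β * f y) = β * crossingIntegral ν a b f := by
    simp only [crossingIntegral, intervalIntegral.integral_const_mul, integral_const_mul]
  rw [hβ, ← hser] at hpart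
  rw [eq_sub_of_add_eq' htail, abs_sub_comm]
  linarith

end ContractiveQuantiles

/-! ### Probability of lying above the diagonal -/

namespace ContractiveQuantiles

variable {a b ρ δ C : ℝ} {ν : Kernel ℝ ℝ} {G : ℝ → ℂ → ℂ} [IsMarkovKernel ν]

/-- Given `Y = y`, a variable with law `ν y` is at least `y` exactly when its quantile level `τ`
satisfies `y ≤ c τ`, with `c` the crossing point. -/
theorem measure_Ici_eq (hq : ContractiveQuantiles a b ρ δ C ν G) {y : ℝ} (hy : y ∈ Icc a b) :
    ν y (Ici y) = volume.restrict (Ioo (0 : ℝ) 1) {τ | y ≤ quantileCrossing ν a b τ} := by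
  conv_lhs => rw [← map_lawQuantile (μ := ν y)]
  rw [Measure.map_apply_of_aemeasurable aemeasurable_lawQuantile measurableSet_Ici]
  refine measure_congr ((ae_restrict_iff' measurableSet_Ioo).2 (ae_of_all _ fun τ hτ => ?_))
  exact propext (hq.self_le_iff hτ hy)

/-- The probability of lying above the diagonal, by conditioning on the quantile level. -/
theorem compProd_above_diagonal (hq : ContractiveQuantiles a b ρ δ C ν G) (Q : Measure ℝ)
    [IsFiniteMeasure Q] (hQ : ∀ᵐ y ∂Q, b < y → ∀ᵐ w ∂ν y, w < y) :
    (Q ⊗ₘ ν) {p | a ≤ p.1 ∧ p.1 ≤ p.2} =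
      ∫⁻ τ in Ioo (0 : ℝ) 1, Q (Icc a (quantileCrossing ν a b τ)) := by
  -- The crossing point is only a.e. measurable in the level; Fubini needs a measurable version.
  have hcm := hq.aemeasurable_crossing
  set c' := hcm.mk _ with hc'
  have hE : MeasurableSet {p : ℝ × ℝ | a ≤ p.1 ∧ p.1 ≤ c' p.2} :=
    (measurableSet_le measurable_const measurable_fst).inter
      (measurableSet_le measurable_fst (hcm.measurable_mk.comp measurable_snd))
  have hs : MeasurableSet {p : ℝ × ℝ | a ≤ p.1 ∧ p.1 ≤ p.2} :=
    (measurableSet_le measurable_const measurable_fst).inter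
      (measurableSet_le measurable_fst measurable_snd)
  rw [Measure.compProd_apply hs]
  calc ∫⁻ y, ν y (Prod.mk y ⁻¹' {p | a ≤ p.1 ∧ p.1 ≤ p.2}) ∂Q
      = ∫⁻ y, volume.restrict (Ioo (0 : ℝ) 1)
          (Prod.mk y ⁻¹' {p : ℝ × ℝ | a ≤ p.1 ∧ p.1 ≤ c' p.2}) ∂Q := by
        refine lintegral_congr_ae ?_
        filter_upwards [hQ] with y hy
        have h1 : volume.restrict (Ioo (0 : ℝ) 1)
            (Prod.mk y ⁻¹' {p : ℝ × ℝ | a ≤ p.1 ∧ p.1 ≤ c' p.2}) =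
            volume.restrict (Ioo (0 : ℝ) 1) {τ | a ≤ y ∧ y ≤ quantileCrossing ν a b τ} := by
          refine measure_congr ?_
          filter_upwards [hcm.ae_eq_mk] with τ hτ
          change (a ≤ y ∧ y ≤ c' τ) = (a ≤ y ∧ y ≤ quantileCrossing ν a b τ)
          rw [hτ]
        rw [h1]
        rcases lt_or_ge y a with hya | hya
        · simp [not_le.2 hya]
        rcases le_or_gt y b with hyb | hyb
        · simp only [preimage_ofPred_eq, hya, true_and]
          exact hq.measure_Ici_eq ⟨hya, hyb⟩
        -- Above `b` both sides vanish: crossing points do not exceed `b`.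
        · have h2 : ν y (Prod.mk y ⁻¹' {p | a ≤ p.1 ∧ p.1 ≤ p.2}) = 0 := by
            refine measure_mono_null (fun w hw => ?_) (ae_iff.1 (hy hyb))
            exact not_lt.2 hw.2
          rw [h2, eq_comm]
          refine measure_mono_null (t := (Ioo (0 : ℝ) 1)ᶜ) (fun τ hτ hmem => ?_) (by simp)
          exact absurd ((hτ.2.trans (hq.crossing_mem hmem).2)) (not_le.2 hyb)
    _ = (Q.prod (volume.restrict (Ioo (0 : ℝ) 1))) {p | a ≤ p.1 ∧ p.1 ≤ c' p.2} :=
        (Measure.prod_apply hE).symm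
    _ = ∫⁻ τ in Ioo (0 : ℝ) 1, Q (Icc a (quantileCrossing ν a b τ)) := by
        rw [Measure.prod_apply_symm hE]
        refine lintegral_congr_ae ?_
        filter_upwards [hcm.ae_eq_mk] with τ hτ
        rw [hτ]
        rfl

/-- Bounds on the distribution function of `Q` carry over to the probability of lying above the
diagonal. -/
theorem compProd_above_diagonal_mem (hq : ContractiveQuantiles a b ρ δ C ν G) (Q : Measure ℝ)
    [IsFiniteMeasure Q] (hQ : ∀ᵐ y ∂Q, b < y → ∀ᵐ w ∂ν y, w < y) {fLo fHi : ℝ → ℝ}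
    (hLo : ContinuousOn fLo (Icc a b)) (hHi : ContinuousOn fHi (Icc a b))
    (henv : ∀ y ∈ Icc a b, Q.real (Icc a y) ∈ Icc (∫ z in a..y, fLo z) (∫ z in a..y, fHi z)) :
    (Q ⊗ₘ ν).real {p | a ≤ p.1 ∧ p.1 ≤ p.2} ∈
      Icc (crossingIntegral ν a b fLo) (crossingIntegral ν a b fHi) := by
  have hmono : MonotoneOn (fun τ => Q (Icc a (quantileCrossing ν a b τ))) (Ioo 0 1) :=
    fun s hs τ hτ hst => measure_mono (Icc_subset_Icc_right (hq.monotoneOn_crossing hs hτ hst))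
  have hmeas : AEMeasurable (fun τ => Q (Icc a (quantileCrossing ν a b τ)))
      (volume.restrict (Ioo (0 : ℝ) 1)) :=
    aemeasurable_restrict_of_monotoneOn measurableSet_Ioo hmono
  have heq : (Q ⊗ₘ ν).real {p | a ≤ p.1 ∧ p.1 ≤ p.2} =
      ∫ τ in Ioo (0 : ℝ) 1, Q.real (Icc a (quantileCrossing ν a b τ)) := by
    rw [Measure.real, hq.compProd_above_diagonal Q hQ]
    exact (integral_toReal hmeas (ae_of_all _ fun τ => measure_lt_top _ _)).symm
  have hint : Integrable (fun τ => Q.real (Icc a (quantileCrossing ν a b τ)))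
      (volume.restrict (Ioo (0 : ℝ) 1)) := by
    refine Integrable.of_bound hmeas.ennreal_toReal.aestronglyMeasurable (Q.real univ)
      (ae_of_all _ fun τ => ?_)
    rw [Real.norm_eq_abs, abs_of_nonneg measureReal_nonneg]
    exact measureReal_mono (subset_univ _)
  rw [heq]
  exact ⟨setIntegral_mono_on (hq.integrable_crossing hLo) hint measurableSet_Ioo
      fun τ hτ => (henv _ (hq.crossing_mem hτ)).1,
    setIntegral_mono_on hint (hq.integrable_crossing hHi) measurableSet_Ioo
      fun τ hτ => (henv _ (hq.crossing_mem hτ)).2⟩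

end ContractiveQuantiles

/-! ### Choices, measurability and weights -/

namespace KinkDesign

variable {dx dθ : ℕ} {Ω : Type*} {D : KinkDesign dx dθ Ω}

section Choice

theorem mInv_mem (hinv : D.Invertible) {x : EuclideanSpace ℝ (Fin dx)} (hx : x ∈ D.XX)
    {θ : EuclideanSpace ℝ (Fin dθ)} (hθ : θ ∈ D.Par) : D.mInv 1 x (D.win 1) θ ∈ D.HH :=
  Function.invFunOn_mem (hinv.win_mem x hx θ hθ)

theorem m_mInv (hinv : D.Invertible) {x : EuclideanSpace ℝ (Fin dx)} (hx : x ∈ D.XX)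
    {θ : EuclideanSpace ℝ (Fin dθ)} (hθ : θ ∈ D.Par) :
    D.m 1 x (D.mInv 1 x (D.win 1) θ) θ = D.win 1 :=
  Function.invFunOn_eq (f := fun η => D.m 1 x η θ) (hinv.win_mem x hx θ hθ)

/-- The reversion of the upper end of the window is at or above the cutoff: a prekink choice below
the cutoff would give, by single crossing, a postkink payoff at least that of the cutoff, against
strict concavity. -/
theorem k_le_reversion [MeasurableSpace Ω] {P : Measure Ω} (hpayoff : D.KinkedPayoff)
    (hopt : D.Optimal)
    (hinv : D.Invertible) (hbasic : D.Basic) (hfric : D.Frictions P)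
    {x : EuclideanSpace ℝ (Fin dx)} (hx : x ∈ D.XX) {θ : EuclideanSpace ℝ (Fin dθ)}
    (hθ : θ ∈ D.Par) : D.k ≤ D.reversion (D.win 1) x θ := by
  by_contra! hlt
  have hη := mInv_mem hinv hx hθ
  have hm1 := m_mInv hinv hx hθ
  rw [reversion] at hlt
  set η := D.mInv 1 x (D.win 1) θ
  have hk : D.k ∈ D.choices := Ioo_subset_Icc_self hbasic.k_mem
  have h0 := hopt.m_mem 0 x hx η hη θ hθ
  have h1 := hopt.m_mem 1 x hx η hη θ hθ
  have hmax0 : D.U 0 D.k x η θ ≤ D.U 0 (D.m 0 x η θ) x η θ := hopt.m_max 0 x hx η hη θ hθ hk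
  have hmax1 := hopt.m_max 1 x hx η hη θ hθ
  have hconc := hpayoff.concave 1 x hx η hη θ hθ
  have hbel := hpayoff.below _ h0 x hx η hη θ hθ hlt
  have hcut := hpayoff.cutoff x hx η hη θ hθ
  have hge : D.U 1 D.k x η θ ≤ D.U 1 (D.m 0 x η θ) x η θ := by linarith
  have hk1 : D.k ≤ D.win 1 := hfric.k_mem.2
  have hlt1 : D.U 1 (D.m 0 x η θ) x η θ < D.U 1 (D.m 1 x η θ) x η θ := by
    refine lt_of_le_of_ne (hmax1 h0) fun he => ?_
    have hmax0' : IsMaxOn (fun y => D.U 1 y x η θ) D.choices (D.m 0 x η θ) := fun y hy => by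
      simpa [he] using hmax1 hy
    have := hconc.eq_of_isMaxOn hmax0' hmax1 h0 h1
    rw [hm1] at this
    linarith
  rcases hk1.eq_or_lt with he | hlt'
  · rw [hm1, ← he] at hlt1; linarith
  · rw [← hm1] at hlt'
    have hseg : D.k ∈ openSegment ℝ (D.m 0 x η θ) (D.m 1 x η θ) := by
      rw [openSegment_eq_Ioo (hlt.trans hlt')]; exact ⟨hlt, hlt'⟩
    have := hconc.lt_on_openSegment h0 h1 (hlt.trans hlt').ne hseg
    rw [min_eq_left hlt1.le] at this
    linarith

theorem payoff_eq_min (hpayoff : D.KinkedPayoff) {y : ℝ} (hy : y ∈ D.choices)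
    {x : EuclideanSpace ℝ (Fin dx)} (hx : x ∈ D.XX) {η : ℝ} (hη : η ∈ D.HH)
    {θ : EuclideanSpace ℝ (Fin dθ)} (hθ : θ ∈ D.Par) :
    D.payoff y x η θ = min (D.U 0 y x η θ) (D.U 1 y x η θ) := by
  rw [payoff]
  split_ifs with h
  · rcases h.eq_or_lt with rfl | h
    · have := hpayoff.cutoff x hx η hη θ hθ
      rw [min_eq_left (by linarith)]
    · have := hpayoff.below y hy x hx η hη θ hθ h
      rw [min_eq_left (by linarith)]
  · have := hpayoff.above y hy x hx η hη θ hθ (not_le.1 h)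
    rw [min_eq_right (by linarith)]

/-- If the kinked payoff is that of policy `d` on an open set containing one of the desired choice
and the policy-`d` choice, the two coincide. A local maximizer of a concave function is a global
one; conversely, the kinked payoff is the minimum of both payoffs, hence strictly concave and
bounded above by the payoff of policy `d`. -/
theorem des_eq_Ycf [MeasurableSpace Ω] (hbasic : D.Basic) (hpayoff : D.KinkedPayoff)
    (hopt : D.Optimal) (d : Fin 2) (ω : Ω) {s : Set ℝ} (hs : IsOpen s)
    (heq : ∀ y ∈ s ∩ D.choices, D.payoff y (D.X ω) (D.eta ω) D.θ₀ =
      D.U d y (D.X ω) (D.eta ω) D.θ₀)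
    (hmem : D.Ydes ω ∈ s ∨ D.Ycf d ω ∈ s) : D.Ydes ω = D.Ycf d ω := by
  have hx := hbasic.X_mem ω
  have hη := hbasic.eta_mem ω
  have hθ := hbasic.par_mem
  have hdes := hopt.des_mem ω
  have hcf : D.Ycf d ω ∈ D.choices := hopt.m_mem d _ hx _ hη _ hθ
  have hmaxd : IsMaxOn (fun y => D.U d y (D.X ω) (D.eta ω) D.θ₀) D.choices (D.Ycf d ω) :=
    hopt.m_max d _ hx _ hη _ hθ
  have hconc := hpayoff.concave d _ hx _ hη _ hθ
  rcases hmem with hmem | hmem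
  · refine hconc.eq_of_isMaxOn ?_ hmaxd hdes hcf
    refine IsMaxOn.of_isLocalMaxOn_of_concaveOn hdes ?_ hconc.concaveOn
    filter_upwards [mem_nhdsWithin_of_mem_nhds (hs.mem_nhds hmem), self_mem_nhdsWithin]
      with y hy hyc
    rw [← heq y ⟨hy, hyc⟩, ← heq _ ⟨hmem, hdes⟩]
    exact hopt.des_max ω hyc
  · have hmin : StrictConcaveOn ℝ D.choices
        (fun y => D.payoff y (D.X ω) (D.eta ω) D.θ₀) := by
      refine ((hpayoff.concave 0 _ hx _ hη _ hθ).inf (hpayoff.concave 1 _ hx _ hη _ hθ)).congr ?_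
      intro y hy
      exact (payoff_eq_min hpayoff hy hx hη hθ).symm
    refine hmin.eq_of_isMaxOn (hopt.des_max ω) (fun y hy => ?_) hdes hcf
    have h1 : D.payoff y (D.X ω) (D.eta ω) D.θ₀ ≤ D.U d y (D.X ω) (D.eta ω) D.θ₀ := by
      rw [payoff_eq_min hpayoff hy hx hη hθ]
      fin_cases d
      · exact min_le_left _ _
      · exact min_le_right _ _
    show D.payoff y (D.X ω) (D.eta ω) D.θ₀ ≤ D.payoff (D.Ycf d ω) (D.X ω) (D.eta ω) D.θ₀
    rw [heq _ ⟨hmem, hcf⟩]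
    exact h1.trans (hmaxd hy)

/-- Observed choices in the window are those of the units whose prekink choice lies between the
lower end of the window and the reversion of its upper end. -/
theorem obs_mem_window_iff [MeasurableSpace Ω] {P : Measure Ω} (hbasic : D.Basic)
    (hpayoff : D.KinkedPayoff) (hopt : D.Optimal) (hinv : D.Invertible) (hfric : D.Frictions P)
    (ω : Ω) : D.Y ω ∈ D.window ↔ D.win 0 ≤ D.Ycf 0 ω ∧ D.Ycf 0 ω ≤ D.W D.θ₀ ω := by
  have hx := hbasic.X_mem ω
  have hη := hbasic.eta_mem ω
  have hθ := hbasic.par_mem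
  have hk := hfric.k_mem
  have hobs : D.Y ω ∈ D.window ↔ D.Ydes ω ∈ D.window := by
    constructor <;> intro h <;> by_contra h'
    · exact h' (hfric.des_outside ω h' ▸ h)
    · exact h' ((hfric.obs_outside ω h').symm ▸ h)
  have hlo : D.Ydes ω < D.win 0 ↔ D.Ycf 0 ω < D.win 0 := by
    have key := des_eq_Ycf hbasic hpayoff hopt 0 ω (isOpen_Iio (a := D.k))
      (fun y hy => if_pos (le_of_lt hy.1))
    exact ⟨fun h => key (.inl (h.trans_le hk.1)) ▸ h, fun h => key (.inr (h.trans_le hk.1)) ▸ h⟩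
  have hhi : D.win 1 < D.Ydes ω ↔ D.win 1 < D.Ycf 1 ω := by
    have key := des_eq_Ycf hbasic hpayoff hopt 1 ω (isOpen_Ioi (a := D.k))
      (fun y hy => if_neg (not_le.2 hy.1))
    exact ⟨fun h => key (.inl (hk.2.trans_lt h)) ▸ h, fun h => key (.inr (hk.2.trans_lt h)) ▸ h⟩
  have hrev : D.Ycf 1 ω ≤ D.win 1 ↔ D.Ycf 0 ω ≤ D.W D.θ₀ ω := by
    have hη' := mInv_mem hinv hx hθ
    have h1 := (hinv.strictMono 1 _ hx _ hθ).le_iff_le hη hη'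
    have h0 := (hinv.strictMono 0 _ hx _ hθ).le_iff_le hη hη'
    simp only [m_mInv hinv hx hθ] at h1
    exact h1.trans h0.symm
  rw [hobs, window, mem_Icc, ← not_lt, hlo, not_lt, ← hrev, ← not_lt (a := D.win 1), hhi, not_lt]

end Choice

section Measurability

variable [MeasurableSpace Ω]

theorem measurable_Ycf (hbasic : D.Basic) (hinv : D.Invertible) (d : Fin 2) :
    Measurable (D.Ycf d) := by
  have h := (hinv.continuous d D.θ₀ hbasic.par_mem).domRestrict.measurable
  exact h.comp ((hbasic.X_meas.prodMk hbasic.eta_meas).subtype_mk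
    (h := fun ω => (⟨hbasic.X_mem ω, hbasic.eta_mem ω⟩ : (D.X ω, D.eta ω) ∈ D.XX ×ˢ D.HH)))

theorem measurable_W (hbasic : D.Basic) (hinv : D.Invertible) {θ : EuclideanSpace ℝ (Fin dθ)}
    (hθ : θ ∈ D.Par) : Measurable (D.W θ) := by
  have h1 : ContinuousOn (fun x => D.mInv 1 x (D.win 1) θ) D.XX :=
    (hinv.inv_continuous 1 θ hθ).comp (f := fun x => (x, D.win 1)) (by fun_prop)
      fun x hx => ⟨hx, hinv.win_mem x hx θ hθ⟩
  have h2 : ContinuousOn (fun x => D.reversion (D.win 1) x θ) D.XX :=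
    (hinv.continuous 0 θ hθ).comp (continuousOn_id.prodMk h1)
      fun x hx => ⟨hx, mInv_mem hinv hx hθ⟩
  exact h2.domRestrict.measurable.comp (hbasic.X_meas.subtype_mk (h := hbasic.X_mem))

end Measurability

section Weight

variable [MeasurableSpace Ω] {P : Measure Ω} [IsProbabilityMeasure P]
  {t : EuclideanSpace ℝ (Fin dx) → ℝ}

theorem integrable_weight (hbasic : D.Basic) (hweight : D.IsWeight P t) :
    Integrable (fun ω => t (D.X ω)) P := by
  obtain ⟨ht, c₁, c₂, -, -, hb, -⟩ := hweight
  refine Integrable.of_bound (ht.comp hbasic.X_meas).aestronglyMeasurable c₂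
    (ae_of_all _ fun ω => ?_)
  rw [Real.norm_eq_abs, abs_of_nonneg (hb ω).1]
  exact (hb ω).2

/-- A set of prekink choices without weight is Lebesgue null: both the conditional mean of the
weight and the density are bounded away from zero. -/
theorem volume_eq_zero_of_integral_weight (hbasic : D.Basic) (hinv : D.Invertible)
    (hfric : D.Frictions P) (hweight : D.IsWeight P t) {A : Set ℝ} (hA : MeasurableSet A)
    (hsub : A ⊆ D.supp 0) (h0 : ∫ ω in D.Ycf 0 ⁻¹' A, t (D.X ω) ∂P ≤ 0) : volume A = 0 := by
  have hT := integrable_weight hbasic hweight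
  obtain ⟨ht, c₁, c₂, hc₁, -, hb, hce⟩ := hweight
  have hY := measurable_Ycf hbasic hinv 0
  have hle : MeasurableSpace.comap (D.Ycf 0) inferInstance ≤ ‹MeasurableSpace Ω› := hY.comap_le
  have hP : P (D.Ycf 0 ⁻¹' A) = 0 := by
    rw [← setIntegral_condExp hle hT ⟨A, hA, rfl⟩] at h0
    have h1 : c₁ * P.real (D.Ycf 0 ⁻¹' A) ≤ ∫ ω in D.Ycf 0 ⁻¹' A,
        (P[fun ω' => t (D.X ω') | MeasurableSpace.comap (D.Ycf 0) inferInstance]) ω ∂P := by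
      have h2 := setIntegral_mono_on_ae (μ := P) (s := D.Ycf 0 ⁻¹' A) (f := fun _ => c₁)
        (integrableOn_const (measure_ne_top _ _)) integrable_condExp.integrableOn (hY hA)
        (hce.mono fun ω hω hmem => hω (hsub hmem))
      rwa [setIntegral_const, smul_eq_mul, mul_comm] at h2
    have h2 : P.real (D.Ycf 0 ⁻¹' A) = 0 := by
      have := measureReal_nonneg (μ := P) (s := D.Ycf 0 ⁻¹' A)
      nlinarith
    exact (measureReal_eq_zero_iff).1 h2
  obtain ⟨e₁, e₂, he₁, -, hdens⟩ := hfric.density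
  obtain ⟨f, hf, hfb, hfeq⟩ := hdens 0
  have h3 := congrArg (fun m => m A) hfeq
  simp only [Measure.restrict_apply hA, inter_eq_left.2 hsub, Measure.map_apply hY hA, hP,
    withDensity_apply _ hA, Measure.restrict_restrict hA] at h3
  rw [eq_comm, setLIntegral_eq_zero_iff hA (by fun_prop)] at h3
  rw [← nonpos_iff_eq_zero]
  refine (measure_mono fun y hy => ?_).trans (ae_iff.1 h3).le
  simp only [mem_ofPred_eq, Classical.not_imp, ENNReal.ofReal_eq_zero, not_le]
  exact ⟨hy, he₁.trans_le (hfb y (hsub hy)).1⟩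

theorem integral_weight_pos (hbasic : D.Basic) (hinv : D.Invertible)
    (hfric : D.Frictions P) (hweight : D.IsWeight P t) : 0 < ∫ ω, t (D.X ω) ∂P := by
  by_contra! hneg
  have h1 := volume_eq_zero_of_integral_weight hbasic hinv hfric hweight (A := D.supp 0)
    measurableSet_Icc subset_rfl ((setIntegral_le_integral (integrable_weight hbasic hweight)
      (ae_of_all _ fun ω => (hweight.2.choose_spec.choose_spec.2.2.1 ω).1)).trans hneg)
  rw [supp, Real.volume_Icc, ENNReal.ofReal_eq_zero] at h1
  have := hfric.win_mem 0
  linarith [this.1, this.2]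

theorem isProbabilityMeasure_weighted (hbasic : D.Basic) (hinv : D.Invertible)
    (hfric : D.Frictions P) (hweight : D.IsWeight P t) : IsProbabilityMeasure (D.weighted P t) := by
  refine ⟨?_⟩
  rw [weighted, Measure.smul_apply, withDensity_apply _ MeasurableSet.univ, Measure.restrict_univ,
    ← ofReal_integral_eq_lintegral_ofReal (integrable_weight hbasic hweight)
      (ae_of_all _ fun ω => (hweight.2.choose_spec.choose_spec.2.2.1 ω).1), smul_eq_mul]
  refine ENNReal.inv_mul_cancel ?_ ENNReal.ofReal_ne_top
  simpa using integral_weight_pos hbasic hinv hfric hweight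

theorem volume_eq_zero_of_weighted (hbasic : D.Basic) (hinv : D.Invertible)
    (hfric : D.Frictions P) (hweight : D.IsWeight P t) {A : Set ℝ} (hA : MeasurableSet A)
    (hsub : A ⊆ D.supp 0) (h0 : D.weighted P t (D.Ycf 0 ⁻¹' A) = 0) : volume A = 0 := by
  refine volume_eq_zero_of_integral_weight hbasic hinv hfric hweight hA hsub ?_
  have hYA := measurable_Ycf hbasic hinv 0 hA
  rw [weighted, Measure.smul_apply, withDensity_apply _ hYA,
    ← ofReal_integral_eq_lintegral_ofReal (integrable_weight hbasic hweight).integrableOn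
      (ae_of_all _ fun ω => (hweight.2.choose_spec.choose_spec.2.2.1 ω).1), smul_eq_mul,
    mul_eq_zero] at h0
  rcases h0 with h0 | h0
  · exact absurd h0 (ENNReal.inv_ne_zero.2 ENNReal.ofReal_ne_top)
  · exact ENNReal.ofReal_eq_zero.1 h0

end Weight

end KinkDesign

/-! ### Range of the conditional quantiles -/

namespace KinkDesign

section Support

variable {dx dθ : ℕ} {Ω : Type*} {D : KinkDesign dx dθ Ω} [MeasurableSpace Ω] {P : Measure Ω}
  [IsProbabilityMeasure P] {t : EuclideanSpace ℝ (Fin dx) → ℝ} {θ : EuclideanSpace ℝ (Fin dθ)}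
  {b : ℝ} {ν : Kernel ℝ ℝ}

/-- Given a prekink choice at or above `k₀`, the reversion of `k₁` almost surely lies in `[k₀, b]`
or below that choice. -/
theorem ae_condLaw_mem (hbasic : D.Basic) (hpayoff : D.KinkedPayoff) (hopt : D.Optimal)
    (hinv : D.Invertible) (hfric : D.Frictions P) (hweight : D.IsWeight P t) (hθ : θ ∈ D.Par)
    (hb : D.IsUpperEdge (D.weighted P t) θ b) (hν : D.IsCondLaw (D.weighted P t) θ ν) :
    ∀ᵐ y ∂(D.weighted P t).map (D.Ycf 0), ∀ᵐ w ∂ν y,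
      D.win 0 ≤ w ∧ (b < w → D.win 0 ≤ y → w < y) := by
  have := hν.1
  have := isProbabilityMeasure_weighted hbasic hinv hfric hweight
  have hY := measurable_Ycf hbasic hinv 0
  have hW := measurable_W hbasic hinv hθ
  refine Measure.ae_ae_of_ae_compProd (p := fun p : ℝ × ℝ =>
    D.win 0 ≤ p.2 ∧ (b < p.2 → D.win 0 ≤ p.1 → p.2 < p.1)) ?_
  rw [← hν.2, ae_map_iff (hY.prodMk hW).aemeasurable]
  · filter_upwards [measure_eq_zero_iff_ae_notMem.1 hb.2.2.2] with ω hω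
    refine ⟨hfric.k_mem.1.trans
      (k_le_reversion hpayoff hopt hinv hbasic hfric (hbasic.X_mem ω) hθ), fun h1 h2 => ?_⟩
    by_contra! h3
    exact hω ⟨h1, h2, h3⟩
  · have h1 : MeasurableSet {p : ℝ × ℝ | D.win 0 ≤ p.2} :=
      measurableSet_le measurable_const measurable_snd
    have h2 : MeasurableSet {p : ℝ × ℝ | b < p.2} :=
      measurableSet_lt measurable_const measurable_snd
    have h3 : MeasurableSet {p : ℝ × ℝ | D.win 0 ≤ p.1} :=
      measurableSet_le measurable_const measurable_fst
    have h4 : MeasurableSet {p : ℝ × ℝ | p.2 < p.1} :=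
      measurableSet_lt measurable_snd measurable_fst
    exact h1.inter (h2.imp (h3.imp h4))

/-- All conditional quantiles at points of `[k₀, b]` lie in `[k₀, b]`: this holds at Lebesgue almost
every point, and the quantiles are continuous. -/
theorem lawQuantile_mem (hbasic : D.Basic) (hpayoff : D.KinkedPayoff) (hopt : D.Optimal)
    (hinv : D.Invertible) (hfric : D.Frictions P) (hweight : D.IsWeight P t) (hθ : θ ∈ D.Par)
    (hb : D.IsUpperEdge (D.weighted P t) θ b) (hν : D.IsCondLaw (D.weighted P t) θ ν)
    {τ : ℝ} (hτ : τ ∈ Ioo (0 : ℝ) 1)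
    (hcont : ContinuousOn (fun y => lawQuantile (ν y) τ) (Icc (D.win 0) b)) {y : ℝ}
    (hy : y ∈ Icc (D.win 0) b) : lawQuantile (ν y) τ ∈ Icc (D.win 0) b := by
  have := hν.1
  have hab := hb.2.2.1
  set a := D.win 0
  have hae := ae_condLaw_mem hbasic hpayoff hopt hinv hfric hweight hθ hb hν
  have hY := measurable_Ycf hbasic hinv 0
  set N : Set ℝ := {z | ν z (Icc a b)ᶜ ≠ 0} ∩ Icc a b with hN
  have hNm : MeasurableSet N :=
    ((Kernel.measurable_coe ν measurableSet_Icc.compl) (measurableSet_singleton 0).compl).inter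
      measurableSet_Icc
  have hN0 : volume N = 0 := by
    refine volume_eq_zero_of_weighted hbasic hinv hfric hweight hNm ?_ ?_
    · exact inter_subset_right.trans (Icc_subset_Icc (hfric.win_mem 0).1.le hb.2.1)
    · rw [← Measure.map_apply hY hNm, measure_eq_zero_iff_ae_notMem]
      filter_upwards [hae] with z hz hzN
      refine hzN.1 (measure_eq_zero_iff_ae_notMem.2 ?_)
      filter_upwards [hz] with w hw hwN
      refine hwN ⟨hw.1, ?_⟩
      by_contra! h
      exact absurd (h.trans (hw.2 h hzN.2.1)) (not_lt.2 hzN.2.2)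
  -- The quantile agrees with its clamp to `[a, b]` almost everywhere, hence by continuity everywhere.
  have hclamp : (fun z => lawQuantile (ν z) τ) =ᵐ[volume.restrict (Icc a b)]
      fun z => max a (min b (lawQuantile (ν z) τ)) := by
    refine (ae_restrict_iff' measurableSet_Icc).2 ?_
    filter_upwards [measure_eq_zero_iff_ae_notMem.1 hN0] with z hz hzab
    have h0 : ν z (Icc a b)ᶜ = 0 := by
      by_contra h
      exact hz ⟨h, hzab⟩
    have h1 : lawQuantile (ν z) τ ∈ Icc a b := lawQuantile_mem_Icc hτ
      (measure_mono_null (t := (Icc (D.win 0) b)ᶜ)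
        (fun w hw hw' => absurd hw'.1 (not_le.2 hw)) h0)
      (measure_mono_null (t := (Icc (D.win 0) b)ᶜ)
        (fun w hw hw' => absurd hw'.2 (not_le.2 hw)) h0)
    rw [min_eq_right h1.2, max_eq_right h1.1]
  have heq := Measure.eqOn_Icc_of_ae_eq volume hab.ne hclamp hcont
    (continuousOn_const.sup (continuousOn_const.inf hcont)) hy
  simp only at heq
  rw [heq]
  exact ⟨le_max_left _ _, max_le hab.le (min_le_left _ _)⟩

theorem exists_contractiveQuantiles (hbasic : D.Basic) (hpayoff : D.KinkedPayoff)
    (hopt : D.Optimal) (hinv : D.Invertible) (hfric : D.Frictions P) (hweight : D.IsWeight P t)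
    (hθ : θ ∈ D.Par) (hb : D.IsUpperEdge (D.weighted P t) θ b)
    (hν : D.IsCondLaw (D.weighted P t) θ ν) {f : ℝ → ℝ} {ρ β δ : ℝ} (hδ : δ < 1)
    (hf : AnalyticityCondition (D.win 0) b f (fun τ y => lawQuantile (ν y) τ) ρ β δ) :
    ∃ C G, ContractiveQuantiles (D.win 0) b ρ δ C ν G := by
  obtain ⟨hρ, -, hδ0, -, G, hG, hctr, C, hC⟩ := hf
  exact ⟨C, G, hb.2.2.1, hρ, hδ0, hδ, hG, fun τ hτ y hy =>
    lawQuantile_mem hbasic hpayoff hopt hinv hfric hweight hθ hb hν hτ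
      ((hG τ hτ).continuousOn hρ) hy, hctr, hC⟩

end Support

end KinkDesign

/-! ### The bounds on the bunching probability -/

theorem theorem2 {dx dθ : ℕ} {Ω : Type*} [MeasurableSpace Ω] (P : Measure Ω)
    [IsProbabilityMeasure P] (D : KinkDesign dx dθ Ω)
    (t : EuclideanSpace ℝ (Fin dx) → ℝ)
    (kbar : EuclideanSpace ℝ (Fin dθ) → ℝ)
    (ν : EuclideanSpace ℝ (Fin dθ) → Kernel ℝ ℝ)
    (fLo fHi : ℝ → ℝ) (ρ βLo βHi δ : ℝ)
    (hbasic : D.Basic) (hpayoff : D.KinkedPayoff) (hopt : D.Optimal) (hinv : D.Invertible)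
    (hfric : D.Frictions P) (hweight : D.IsWeight P t)
    (hkbar : ∀ θ ∈ D.Par, D.IsUpperEdge (D.weighted P t) θ (kbar θ))
    (hν : ∀ θ ∈ D.Par, D.IsCondLaw (D.weighted P t) θ (ν θ))
    (hδ : δ < 1)
    (hHi : ∀ θ ∈ D.Par, AnalyticityCondition (D.win 0) (kbar θ) fHi
      (fun τ y => lawQuantile (ν θ y) τ) ρ βHi δ)
    (hLo : ∀ θ ∈ D.Par, AnalyticityCondition (D.win 0) (kbar θ) fLo
      (fun τ y => lawQuantile (ν θ y) τ) ρ βLo δ)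
    (henv : ∀ y ∈ Icc (D.win 0) (kbar D.θ₀),
      (D.weighted P t).real {ω | D.win 0 ≤ D.Ycf 0 ω ∧ D.Ycf 0 ω ≤ y} ∈
        Icc (∫ z in (D.win 0)..y, fLo z) (∫ z in (D.win 0)..y, fHi z)) :
    (∀ θ ∈ D.Par, MomentSeriesDefined (ν θ) (D.win 0) (kbar θ) fLo ∧
      MomentSeriesDefined (ν θ) (D.win 0) (kbar θ) fHi) ∧
    (D.weighted P t).real {ω | D.Y ω ∈ D.window} ∈
      Icc (momentSeries (ν D.θ₀) (D.win 0) (kbar D.θ₀) fLo)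
        (momentSeries (ν D.θ₀) (D.win 0) (kbar D.θ₀) fHi) ∧
    (∀ θ ∈ D.Par, (∀ y ∈ Icc (D.win 0) (kbar θ), 0 ≤ fHi y) →
      RelativeVariationBound (D.win 0) (kbar θ) fHi ρ βHi → ∀ l : ℕ,
      |momentTail (ν θ) (D.win 0) (kbar θ) fHi l| ≤
        βHi * δ ^ l * momentSeries (ν θ) (D.win 0) (kbar θ) fHi) ∧
    (∀ θ ∈ D.Par, (∀ y ∈ Icc (D.win 0) (kbar θ), 0 ≤ fLo y) →
      RelativeVariationBound (D.win 0) (kbar θ) fLo ρ βLo → ∀ l : ℕ,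
      |momentTail (ν θ) (D.win 0) (kbar θ) fLo l| ≤
        βLo * δ ^ l * momentSeries (ν θ) (D.win 0) (kbar θ) fLo) := by
  have hq := fun θ (hθ : θ ∈ D.Par) => KinkDesign.exists_contractiveQuantiles hbasic hpayoff hopt
    hinv hfric hweight hθ (hkbar θ hθ) (hν θ hθ) hδ (hHi θ hθ)
  have hLo' := fun θ (hθ : θ ∈ D.Par) => (hLo θ hθ).2.2.2.1
  have hHi' := fun θ (hθ : θ ∈ D.Par) => (hHi θ hθ).2.2.2.1
  refine ⟨fun θ hθ => ?_, ?_, fun θ hθ hf hvar l => ?_, fun θ hθ hf hvar l => ?_⟩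
  · have := (hν θ hθ).1
    obtain ⟨C, G, hq⟩ := hq θ hθ
    obtain ⟨FLo, hFLo, -⟩ := hLo' θ hθ
    obtain ⟨FHi, hFHi, -⟩ := hHi' θ hθ
    exact ⟨hq.momentSeriesDefined hFLo, hq.momentSeriesDefined hFHi⟩
  · have hθ := hbasic.par_mem
    have := (hν _ hθ).1
    have := KinkDesign.isProbabilityMeasure_weighted hbasic hinv hfric hweight
    obtain ⟨C, G, hq⟩ := hq _ hθ
    obtain ⟨FLo, hFLo, -⟩ := hLo' _ hθ
    obtain ⟨FHi, hFHi, -⟩ := hHi' _ hθ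
    have hY := KinkDesign.measurable_Ycf hbasic hinv 0
    have hW := KinkDesign.measurable_W hbasic hinv hθ
    rw [momentSeries, momentSeries, (hq.hasSum_momentTerm hFLo).tsum_eq,
      (hq.hasSum_momentTerm hFHi).tsum_eq]
    have hs : MeasurableSet {p : ℝ × ℝ | D.win 0 ≤ p.1 ∧ p.1 ≤ p.2} :=
      (measurableSet_le measurable_const measurable_fst).inter
        (measurableSet_le measurable_fst measurable_snd)
    have hbunch : {ω | D.Y ω ∈ D.window} =
        (fun ω => (D.Ycf 0 ω, D.W D.θ₀ ω)) ⁻¹' {p | D.win 0 ≤ p.1 ∧ p.1 ≤ p.2} := by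
      ext ω
      exact KinkDesign.obs_mem_window_iff hbasic hpayoff hopt hinv hfric ω
    rw [hbunch, ← map_measureReal_apply (hY.prodMk hW) hs, (hν _ hθ).2]
    refine hq.compProd_above_diagonal_mem _ ?_ (hFLo.continuousOn hq.rho_pos)
      (hFHi.continuousOn hq.rho_pos) fun y hy => ?_
    · filter_upwards [KinkDesign.ae_condLaw_mem hbasic hpayoff hopt hinv hfric hweight hθ
        (hkbar _ hθ) (hν _ hθ)] with y hy hby
      filter_upwards [hy] with w hw
      rcases le_or_gt w (kbar D.θ₀) with h | h
      · exact h.trans_lt hby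
      · exact hw.2 h (hq.lt.le.trans hby.le)
    · rw [map_measureReal_apply hY measurableSet_Icc]
      exact henv y hy
  · have := (hν θ hθ).1
    obtain ⟨C, G, hq⟩ := hq θ hθ
    exact hq.abs_momentTail_le hf hvar l
  · have := (hν θ hθ).1
    obtain ⟨C, G, hq⟩ := hq θ hθ
    exact hq.abs_momentTail_le hf hvar l
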